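/- Call a compact group $G$ $D$-quasirandom if every irreducible unitary representation of $G$ other than the one-dimensional identity representation has complex dimension at least $D$. There is an absolute constant $C>0$ such that for every $\varepsilon\in(0,1/2)$ the number $D=\exp\big((1/\varepsilon)^{C}\big)$ has the following property. Let $G$ be a $D$-quasirandom compact metrizable group with Haar probability measure $m_G$, let $m_{G\times G}=m_G\times m_G$, let $E\subseteq G\times G$ be Borel, and put $\delta:=m_{G\times G}(E)$. Then the set \[B:=\Big\{g\in G:\ m_{G\times G}\big\{(x,y)\in G\times G:\ \{(x,y),(gx,y),(gx,gy)\}\subseteq E\big\}\ \ge\ \delta^4-\varepsilon\Big\}\] is Borel and satisfies $m_G(B)\ge 1-\varepsilon$. -/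

import Mathlib

open MeasureTheory

/-- A representation of a topological group on a complex inner product space is unitary if every
group element acts by a norm-preserving map (a linear isometry, bijective because the group element
has an inverse) and the action is strongly continuous. -/
structure IsUnitaryRep {G V : Type*} [Group G] [TopologicalSpace G] [NormedAddCommGroup V]
    [InnerProductSpace ℂ V] (ρ : Representation ℂ G V) : Prop where
  norm_map : ∀ (g : G) (v : V), ‖ρ g v‖ = ‖v‖
  continuous : ∀ v : V, Continuous fun g : G => ρ g v

/-- A topological group is `D`-quasirandom if it has no irreducible unitary representation of
complex dimension less than `D` apart from the identity representation. Every Hilbert space of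
finite dimension `n` is isometrically isomorphic to `EuclideanSpace ℂ (Fin n)`, so it suffices to
speak about representations on these spaces; infinite-dimensional ones satisfy no constraint. -/
def IsQuasirandom (D : ℝ) (G : Type*) [Group G] [TopologicalSpace G] : Prop :=
  ∀ (n : ℕ) (ρ : Representation ℂ G (EuclideanSpace ℂ (Fin n))),
    IsUnitaryRep ρ → ρ.IsIrreducible → ¬ ρ.IsTrivial → D ≤ (n : ℝ)

/-- The set of base points `(x, y)` for which the Bergelson-McCutcheon-Zhang corner
`{(x, y), (g x, y), (g x, g y)}` is contained in `E`. -/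
def bmzCorners {G : Type*} [Group G] (E : Set (G × G)) (g : G) : Set (G × G) :=
  {p | ({(p.1, p.2), (g * p.1, p.2), (g * p.1, g * p.2)} : Set (G × G)) ⊆ E}

/-!
The number of corners `(x, y), (g * x, y), (g * x, g * y)` in `E` is, in the coordinates `x' = g * x`,
`y` and `z = x⁻¹ * y`, a number of triangles: `E` gives a weight to each of the pairs `(y, z)`,
`(z, x')` and `(x', y)`, and the shift is `g = x' * z * y⁻¹`. The proof rests on the fact that left
translation on a quasirandom group mixes functions quantitatively (`IsQuasirandom.isMixing`): for
`f`, `h` in `L²(G)` with `h` of mean zero, the operator sending `f` to its matrix coefficients against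
`h` is compact, and an eigenspace of its absolute square for the largest eigenvalue is a
finite-dimensional representation without fixed vectors, hence of dimension at least `D`. As the
Hilbert–Schmidt norm of the operator is at most `‖h‖`, its operator norm is at most `‖h‖ / √D`.

Mixing is used twice.

* The corner count hardly depends on `g`. Its correlation with a mean-zero function `φ` of `g` is a
  triangle count weighted by `φ (x' * z * y⁻¹)`. Two applications of Cauchy–Schwarz bound it by a box
  norm of that weight, which mixing makes small
  (`IsMixing.pow_four_integral_mul_cornerCount_le`).
* The mean of the corner counts is at least `δ ^ 4` up to a small error
  (`IsMixing.le_integral_cornerCount`). By weak regularity (`exists_weak_regular`) the three weights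
  can be replaced by conditional expectations on partitions into `exp (O(1 / ε ^ 2))` cells, and for
  these it does not matter whether `z` is an independent variable or equal to `x'⁻¹ * y`, because
  the errors provided by mixing are summed over `exp (O(1 / ε ^ 2))` cells only. If `z = x'⁻¹ * y`,
  the three weights become the indicator of `E` at `(x', y)`, so the three functions are
  conditional expectations of the indicator of `E` on the same probability space, and the integral
  of their product is at least `δ ^ 4` by Chu's inequality
  (`pow_four_le_integral_fiberAverages`).
-/

/-! ### Matrix coefficients of unitary representations -/

section MatrixCoefficients

open scoped InnerProductSpace BoundedContinuousFunction

variable {G H : Type*} [Group G] [TopologicalSpace G] [NormedAddCommGroup H]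
  [InnerProductSpace ℂ H]

theorem IsUnitaryRep.inner_map_map {ρ : Representation ℂ G H} (hρ : IsUnitaryRep ρ) (g : G)
    (v w : H) : ⟪ρ g v, ρ g w⟫_ℂ = ⟪v, w⟫_ℂ :=
  (LinearMap.norm_map_iff_inner_map_map (ρ g)).1 (hρ.norm_map g) v w

/-- A finite-dimensional invariant subspace without nonzero fixed vectors contains an invariant
subspace carrying a nontrivial irreducible representation, so in a `D`-quasirandom group its
dimension is at least `D`. The subspace used is an invariant one of minimal positive dimension. -/
theorem IsUnitaryRep.le_finrank_of_invariant {D : ℝ} {ρ : Representation ℂ G H}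
    (hρ : IsUnitaryRep ρ) (hq : IsQuasirandom D G) (V : Submodule ℂ H) [FiniteDimensional ℂ V]
    (hV : V ≠ ⊥) (hinv : ∀ g, ∀ v ∈ V, ρ g v ∈ V)
    (hfix : ∀ v ∈ V, (∀ g, ρ g v = v) → v = 0) : D ≤ Module.finrank ℂ V := by
  classical
  have hex : ∃ n : ℕ, ∃ W : Submodule ℂ H, W ≤ V ∧ W ≠ ⊥ ∧ (∀ g, ∀ v ∈ W, ρ g v ∈ W) ∧
      Module.finrank ℂ W = n := ⟨_, V, le_rfl, hV, hinv, rfl⟩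
  obtain ⟨W, hWV, hW, hWinv, hWn⟩ := Nat.find_spec hex
  have hmin : ∀ U : Submodule ℂ H, U ≤ V → U ≠ ⊥ → (∀ g, ∀ v ∈ U, ρ g v ∈ U) →
      Module.finrank ℂ W ≤ Module.finrank ℂ U := fun U h1 h2 h3 =>
    hWn.symm ▸ Nat.find_min' hex ⟨U, h1, h2, h3, rfl⟩
  clear hWn
  have : FiniteDimensional ℂ W := Submodule.finiteDimensional_of_le hWV
  let e := (stdOrthonormalBasis ℂ W).repr
  let σ : Representation ℂ G (EuclideanSpace ℂ (Fin (Module.finrank ℂ W))) :=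
    { toFun := fun g =>
        e.toLinearEquiv.toLinearMap ∘ₗ (ρ g).restrict (hWinv g) ∘ₗ e.symm.toLinearEquiv.toLinearMap
      map_one' := by
        ext1 v
        simp [LinearMap.restrict_apply]
      map_mul' := fun a b => by
        refine LinearMap.ext fun v => ?_
        simp [LinearMap.restrict_apply] }
  have hσ : ∀ (g : G) (w : W), σ g (e w) = e ⟨ρ g w, hWinv g w w.2⟩ := fun g w => by
    simp [σ, LinearMap.restrict_apply]
  have hσu : IsUnitaryRep σ := by
    constructor
    · intro g v
      obtain ⟨w, rfl⟩ := e.surjective v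
      rw [hσ, e.norm_map, e.norm_map]
      exact hρ.norm_map g w
    · intro v
      obtain ⟨w, rfl⟩ := e.surjective v
      simp only [hσ]
      exact e.continuous.comp ((hρ.continuous (w : H)).subtype_mk _)
  have hWpos : 0 < Module.finrank ℂ W := by
    rw [Module.finrank_pos_iff, Submodule.nontrivial_iff_ne_bot]
    exact hW
  have hirr : σ.IsIrreducible := by
    have : Nontrivial (Subrepresentation σ) := by
      refine ⟨⊥, ⊤, fun h => ?_⟩
      have h' : (⊥ : Submodule ℂ (EuclideanSpace ℂ (Fin (Module.finrank ℂ W)))) = ⊤ :=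
        congrArg Subrepresentation.toSubmodule h
      have := congrArg (fun U : Submodule ℂ _ => Module.finrank ℂ U) h'
      simp at this
      omega
    constructor
    intro U
    let U' : Submodule ℂ H := (U.toSubmodule.comap e.toLinearEquiv.toLinearMap).map W.subtype
    have hU'W : U' ≤ W := Submodule.map_subtype_le _ _
    have hmem : ∀ w : W, (w : H) ∈ U' ↔ e w ∈ U.toSubmodule := fun w => by
      simp [U']
    have hU'inv : ∀ g, ∀ v ∈ U', ρ g v ∈ U' := fun g v hv => by
      have h1 := U.apply_mem_toSubmodule g ((hmem ⟨v, hU'W hv⟩).1 hv)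
      rw [hσ] at h1
      exact (hmem ⟨ρ g v, _⟩).2 h1
    by_cases hU' : U' = ⊥
    · left
      apply Subrepresentation.toSubmodule_injective
      change U.toSubmodule = ⊥
      rw [eq_bot_iff]
      intro v hv
      obtain ⟨w, rfl⟩ := e.surjective v
      have := (hmem w).2 hv
      rw [hU', Submodule.mem_bot] at this
      have : w = 0 := Subtype.ext this
      simp [this]
    · right
      have heq : U' = W := Submodule.eq_of_le_of_finrank_le hU'W
        (hmin U' (hU'W.trans hWV) hU' hU'inv)
      apply Subrepresentation.toSubmodule_injective
      change U.toSubmodule = ⊤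
      rw [eq_top_iff]
      intro v _
      obtain ⟨w, rfl⟩ := e.surjective v
      refine (hmem w).1 ?_
      rw [heq]
      exact w.2
  have hnt : ¬ σ.IsTrivial := by
    intro ht
    apply hW
    rw [eq_bot_iff]
    intro w hw
    refine hfix w (hWV hw) fun g => ?_
    have h1 := hσ g ⟨w, hw⟩
    rw [Representation.isTrivial_apply] at h1
    exact (congrArg Subtype.val (e.injective h1)).symm
  exact (hq _ σ hσu hirr hnt).trans (by exact_mod_cast Submodule.finrank_mono hWV)

/-- The map sending `v` to its matrix coefficient `g ↦ ⟪ρ g h, v⟫` against a fixed vector `h`. -/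
noncomputable def IsUnitaryRep.coeff [CompactSpace G] {ρ : Representation ℂ G H}
    (hρ : IsUnitaryRep ρ) (h : H) : H →L[ℂ] (G →ᵇ ℂ) :=
  LinearMap.mkContinuous
    { toFun := fun v => BoundedContinuousFunction.mkOfCompact
        ⟨fun g => ⟪ρ g h, v⟫_ℂ, (hρ.continuous h).inner continuous_const⟩
      map_add' := fun v w => by ext g; simp
      map_smul' := fun c v => by ext g; simp }
    ‖h‖ (fun v => by
      refine (BoundedContinuousFunction.norm_le (by positivity)).2 fun g => ?_
      exact (norm_inner_le_norm _ _).trans_eq (by rw [hρ.norm_map]))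

/-- The matrix coefficients against a fixed vector of the vectors in the unit ball are
equicontinuous, with the modulus of continuity of the orbit map `g ↦ ρ g h`; hence Arzelà–Ascoli. -/
theorem IsUnitaryRep.isCompactOperator_coeff [CompactSpace G] {ρ : Representation ℂ G H}
    (hρ : IsUnitaryRep ρ) (h : H) : IsCompactOperator (hρ.coeff h) := by
  refine (isCompactOperator_iff_isCompact_closure_image_closedBall
    (hρ.coeff h : H →ₗ[ℂ] (G →ᵇ ℂ)) one_pos).2 ?_
  refine BoundedContinuousFunction.arzela_ascoli (Metric.closedBall 0 ‖h‖)
    (isCompact_closedBall _ _) _ ?_ ?_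
  · rintro _ g ⟨v, hv, rfl⟩
    rw [mem_closedBall_zero_iff] at hv ⊢
    change ‖⟪ρ g h, v⟫_ℂ‖ ≤ _
    refine (norm_inner_le_norm _ _).trans ?_
    rw [hρ.norm_map]
    exact mul_le_of_le_one_right (norm_nonneg _) hv
  · intro g
    rw [Metric.equicontinuousAt_iff_right]
    intro ε hε
    have hc := Metric.tendsto_nhds.1 ((hρ.continuous h).tendsto g) ε hε
    filter_upwards [hc] with g' hg'
    rintro ⟨_, v, hv, rfl⟩
    rw [mem_closedBall_zero_iff] at hv
    change dist ⟪ρ g h, v⟫_ℂ ⟪ρ g' h, v⟫_ℂ < ε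
    rw [dist_comm, dist_eq_norm, ← inner_sub_left]
    refine (norm_inner_le_norm _ _).trans_lt ((mul_le_of_le_one_right (norm_nonneg _) hv).trans_lt ?_)
    rwa [← dist_eq_norm]

/-- Matrix coefficients of a unitary representation of a `D`-quasirandom group are small in mean
square, as soon as one of the two vectors is orthogonal to all fixed vectors.

With `T v = (g ↦ ⟪ρ g h, v⟫)`, viewed in `L²(G)`, the compact operator `T* T` commutes with `ρ` and
has an eigenvalue of modulus `‖T‖²`. Bessel's inequality bounds `‖T‖²` times the dimension of the
eigenspace by `‖h‖²`, and quasirandomness bounds that dimension from below by `D`. -/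
theorem IsUnitaryRep.integral_norm_inner_sq_le [IsTopologicalGroup G] [CompactSpace G]
    [CompleteSpace H] [MeasurableSpace G] [BorelSpace G] (m : Measure G) [m.IsMulLeftInvariant]
    [IsProbabilityMeasure m]
    {D : ℝ} {ρ : Representation ℂ G H} (hρ : IsUnitaryRep ρ) (hq : IsQuasirandom D G) (h : H)
    (hfix : ∀ v, (∀ g, ρ g v = v) → ⟪h, v⟫_ℂ = 0)
    (f : H) :
    D * ∫ g, ‖⟪ρ g h, f⟫_ℂ‖ ^ 2 ∂m ≤ ‖h‖ ^ 2 * ‖f‖ ^ 2 := by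
  let T : H →L[ℂ] Lp ℂ 2 m := BoundedContinuousFunction.toLp 2 m ℂ ∘L hρ.coeff h
  have hTnorm : ∀ v w, ⟪T v, T w⟫_ℂ = ∫ g, ⟪⟪ρ g h, v⟫_ℂ, ⟪ρ g h, w⟫_ℂ⟫_ℂ ∂m := by
    intro v w
    rw [L2.inner_def]
    refine integral_congr_ae ?_
    filter_upwards [BoundedContinuousFunction.coeFn_toLp (p := 2) m ℂ (hρ.coeff h v),
      BoundedContinuousFunction.coeFn_toLp (p := 2) m ℂ (hρ.coeff h w)] with g h1 h2
    change ⟪(BoundedContinuousFunction.toLp 2 m ℂ (hρ.coeff h v) : Lp ℂ 2 m) g,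
      (BoundedContinuousFunction.toLp 2 m ℂ (hρ.coeff h w) : Lp ℂ 2 m) g⟫_ℂ = _
    rw [h1, h2]
    rfl
  have hTsq : ∀ v, ‖T v‖ ^ 2 = ∫ g, ‖⟪ρ g h, v⟫_ℂ‖ ^ 2 ∂m := by
    intro v
    have := hTnorm v v
    simp only [inner_self_eq_norm_sq_to_K] at this
    have h2 : ((‖T v‖ ^ 2 : ℝ) : ℂ) = ((∫ g, ‖⟪ρ g h, v⟫_ℂ‖ ^ 2 ∂m : ℝ) : ℂ) := by
      rw [← integral_complex_ofReal]
      push_cast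
      exact this
    exact_mod_cast h2
  have hcomm : ∀ g v w, ⟪T (ρ g v), T (ρ g w)⟫_ℂ = ⟪T v, T w⟫_ℂ := by
    intro g v w
    rw [hTnorm, hTnorm, ← integral_mul_left_eq_self _ g]
    simp only [map_mul, Module.End.mul_apply, hρ.inner_map_map]
  let S : H →L[ℂ] H := ContinuousLinearMap.adjoint T ∘L T
  have hSinner : ∀ v w, ⟪v, S w⟫_ℂ = ⟪T v, T w⟫_ℂ := fun v w => by
    simp [S, ContinuousLinearMap.adjoint_inner_right]
  have hScomm : ∀ g v, S (ρ g v) = ρ g (S v) := by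
    intro g v
    refine ext_inner_left ℂ fun w => ?_
    have hw : w = ρ g (ρ g⁻¹ w) := by
      rw [← Module.End.mul_apply, ← map_mul]; simp
    rw [hw, hSinner, hcomm, hρ.inner_map_map, hSinner]
  have hScpt : IsCompactOperator S :=
    (hρ.isCompactOperator_coeff h).clm_comp
      (ContinuousLinearMap.adjoint T ∘L BoundedContinuousFunction.toLp 2 m ℂ)
  have hSsa : IsSelfAdjoint S := by
    rw [ContinuousLinearMap.isSelfAdjoint_iff_isSymmetric]
    intro v w
    change ⟪S v, w⟫_ℂ = ⟪v, S w⟫_ℂ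
    rw [hSinner, ← inner_conj_symm, hSinner, inner_conj_symm]
  have hmain : D * ‖T‖ ^ 2 ≤ ‖h‖ ^ 2 := by
    by_cases hT0 : T = 0
    · simp [hT0]
    have hTpos : 0 < ‖T‖ := norm_pos_iff.2 hT0
    have hHnt : Nontrivial H := by
      by_contra hcon
      rw [not_nontrivial_iff_subsingleton] at hcon
      exact hT0 (by ext1 v; rw [Subsingleton.elim v 0]; simp)
    obtain ⟨k, hk, hkn⟩ := spectrum.exists_nnnorm_eq_spectralRadius S
    rw [S.spectralRadius_eq_nnnorm hSsa, ENNReal.coe_inj] at hkn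
    have hkn' : ‖k‖ = ‖T‖ ^ 2 := by
      rw [sq, ← ContinuousLinearMap.norm_adjoint_comp_self T]
      exact congrArg NNReal.toReal hkn
    have hk0 : k ≠ 0 := by
      rw [← norm_pos_iff, hkn']
      positivity
    have hev := (hScpt.hasEigenvalue_iff_mem_spectrum hk0).2 hk
    let V := Module.End.eigenspace (S : H →ₗ[ℂ] H) k
    have hVmem : ∀ v, v ∈ V ↔ S v = k • v := fun v => Module.End.mem_eigenspace_iff
    have : FiniteDimensional ℂ V := S.finite_dimensional_eigenspace hScpt k hk0
    have hTV : ∀ v ∈ V, ‖T v‖ ^ 2 = ‖k‖ * ‖v‖ ^ 2 := by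
      intro v hv
      have h1 := hSinner v v
      rw [(hVmem v).1 hv, inner_smul_right, inner_self_eq_norm_sq_to_K,
        inner_self_eq_norm_sq_to_K] at h1
      have h2 := congrArg norm h1
      simp only [norm_mul, norm_pow, RCLike.norm_ofReal, abs_norm] at h2
      exact h2.symm
    have hdim : D ≤ Module.finrank ℂ V := by
      refine hρ.le_finrank_of_invariant hq V hev ?_ ?_
      · intro g v hv
        rw [hVmem, hScomm, (hVmem v).1 hv, map_smul]
      · intro v hv hvfix
        -- A fixed vector in the eigenspace pairs to zero with every translate of `h`.
        have h0 : ‖T v‖ ^ 2 = 0 := by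
          rw [hTsq]
          have : ∀ g, ⟪ρ g h, v⟫_ℂ = 0 := fun g => by
            conv_lhs => rw [← hvfix g]
            rw [hρ.inner_map_map, hfix v hvfix]
          simp [this]
        rw [hTV v hv, mul_eq_zero] at h0
        simpa [hk0] using h0
    let b := stdOrthonormalBasis ℂ V
    have hb : Orthonormal ℂ (fun i => (b i : H)) :=
      b.orthonormal.comp_linearIsometry V.subtypeₗᵢ
    have hbessel : Module.finrank ℂ V * ‖T‖ ^ 2 ≤ ‖h‖ ^ 2 := by
      calc (Module.finrank ℂ V : ℝ) * ‖T‖ ^ 2 = ∑ i, ‖T (b i)‖ ^ 2 := by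
            have : ∀ i, ‖T (b i)‖ ^ 2 = ‖T‖ ^ 2 := fun i => by
              rw [hTV _ (b i).2, hkn', hb.1 i]
              simp
            simp [this]
        _ = ∑ i, ∫ g, ‖⟪ρ g h, (b i : H)⟫_ℂ‖ ^ 2 ∂m := by simp only [hTsq]
        _ = ∫ g, ∑ i, ‖⟪ρ g h, (b i : H)⟫_ℂ‖ ^ 2 ∂m := by
            refine (integral_finsetSum _ fun i _ => ?_).symm
            exact (((hρ.continuous h).inner continuous_const).norm.pow 2).integrable_of_hasCompactSupport
              (HasCompactSupport.of_compactSpace _)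
        _ ≤ ∫ _, ‖h‖ ^ 2 ∂m := by
            refine integral_mono_of_nonneg (ae_of_all _ fun g => by positivity)
              (integrable_const _) (ae_of_all _ fun g => ?_)
            have := hb.sum_inner_products_le (ρ g h) (s := Finset.univ)
            rw [hρ.norm_map] at this
            refine le_trans (le_of_eq ?_) this
            exact Finset.sum_congr rfl fun i _ => by rw [norm_inner_symm]
        _ = ‖h‖ ^ 2 := by simp
    exact (mul_le_mul_of_nonneg_right hdim (by positivity)).trans hbessel
  calc D * ∫ g, ‖⟪ρ g h, f⟫_ℂ‖ ^ 2 ∂m = D * ‖T f‖ ^ 2 := by rw [hTsq]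
    _ ≤ ‖h‖ ^ 2 * ‖f‖ ^ 2 := by
      rcases le_or_gt D 0 with hD | hD
      · exact (mul_nonpos_of_nonpos_of_nonneg hD (by positivity)).trans (by positivity)
      · calc D * ‖T f‖ ^ 2 ≤ D * (‖T‖ * ‖f‖) ^ 2 := by gcongr; exact T.le_opNorm f
          _ = D * ‖T‖ ^ 2 * ‖f‖ ^ 2 := by ring
          _ ≤ _ := by gcongr

end MatrixCoefficients

/-! ### Mixing of translations on quasirandom groups -/

section Mixing

open scoped InnerProductSpace

/-- Left translation is `κ`-mixing if, for functions `a`, `b` bounded by `1`, the correlation of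
`a` with a translate of `b` differs from the product of their integrals by at most `κ` on average
over the translation. -/
def IsMixing {G : Type*} [Group G] [MeasurableSpace G] (κ : ℝ) (m : Measure G) : Prop :=
  ∀ a b : G → ℝ, Measurable a → Measurable b → (∀ x, |a x| ≤ 1) → (∀ x, |b x| ≤ 1) →
    ∫ g, |∫ x, a x * b (g * x) ∂m - (∫ x, a x ∂m) * ∫ x, b x ∂m| ∂m ≤ κ

theorem integrable_of_abs_le {Ω : Type*} [MeasurableSpace Ω] {μ : Measure Ω} [IsFiniteMeasure μ]
    {f : Ω → ℝ} (hf : Measurable f) {C : ℝ} (hC : ∀ x, |f x| ≤ C) : Integrable f μ :=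
  Integrable.of_bound hf.aestronglyMeasurable C (ae_of_all _ hC)

theorem sq_integral_le_integral_sq {Ω : Type*} [MeasurableSpace Ω] {μ : Measure Ω}
    [IsProbabilityMeasure μ] {f : Ω → ℝ} (hf : Measurable f) {C : ℝ} (hC : ∀ x, |f x| ≤ C) :
    (∫ x, f x ∂μ) ^ 2 ≤ ∫ x, f x ^ 2 ∂μ := by
  have hi := integrable_of_abs_le (μ := μ) hf hC
  have hi2 : Integrable (fun x => f x ^ 2) μ :=
    integrable_of_abs_le (hf.pow_const 2) (C := C ^ 2) fun x => by
      rw [abs_pow]; exact pow_le_pow_left₀ (abs_nonneg _) (hC x) 2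
  have h := integral_mono ((hi.const_mul (2 * ∫ x, f x ∂μ)).sub
    (integrable_const ((∫ x, f x ∂μ) ^ 2))) hi2 fun x => by
      change 2 * (∫ x, f x ∂μ) * f x - (∫ x, f x ∂μ) ^ 2 ≤ f x ^ 2
      nlinarith [sq_nonneg (f x - ∫ x, f x ∂μ)]
  rw [integral_sub' (hi.const_mul _) (integrable_const _), integral_const_mul] at h
  simp only [integral_const, probReal_univ, one_smul] at h
  linarith

theorem sq_abs_integral_le {Ω : Type*} [MeasurableSpace Ω] {μ : Measure Ω}
    [IsProbabilityMeasure μ] {f : Ω → ℝ} (hf : Measurable f) {C : ℝ} (hC : ∀ x, |f x| ≤ C) :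
    (∫ x, |f x| ∂μ) ^ 2 ≤ ∫ x, f x ^ 2 ∂μ := by
  have := sq_integral_le_integral_sq (μ := μ) hf.abs (C := C) (fun x => by rw [abs_abs]; exact hC x)
  simpa only [sq_abs] using this

theorem abs_integral_le_one {Ω : Type*} [MeasurableSpace Ω] {μ : Measure Ω}
    [IsProbabilityMeasure μ] {f : Ω → ℝ} (hC : ∀ x, |f x| ≤ 1) :
    |∫ x, f x ∂μ| ≤ 1 := by
  have := norm_integral_le_of_norm_le_const (μ := μ) (f := f) (C := 1) (ae_of_all _ hC)
  simpa using this

theorem norm_sq_toLp_ofReal {Ω : Type*} [MeasurableSpace Ω] {μ : Measure Ω} {r : Ω → ℝ}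
    (hr : MemLp (fun x => (r x : ℂ)) 2 μ) : ‖hr.toLp _‖ ^ 2 = ∫ x, r x ^ 2 ∂μ := by
  have h : ((‖hr.toLp _‖ ^ 2 : ℝ) : ℂ) = ((∫ x, r x ^ 2 ∂μ : ℝ) : ℂ) := by
    rw [← integral_complex_ofReal, Complex.ofReal_pow]
    refine (inner_self_eq_norm_sq_to_K (𝕜 := ℂ) (hr.toLp _)).symm.trans ?_
    rw [L2.inner_def]
    refine integral_congr_ae ?_
    filter_upwards [hr.coeFn_toLp] with x hx
    rw [hx]
    simp [sq, ← Complex.ofReal_mul]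
  exact_mod_cast h

variable {G : Type*} [Group G] [TopologicalSpace G] [IsTopologicalGroup G] [CompactSpace G]
  [MeasurableSpace G] [BorelSpace G]

theorem isMulRightInvariant_of_compactSpace (m : Measure G) [m.IsHaarMeasure]
    [IsProbabilityMeasure m] : m.IsMulRightInvariant := by
  constructor
  intro g
  have : IsProbabilityMeasure (m.map (· * g)) :=
    Measure.isProbabilityMeasure_map (measurable_mul_const g).aemeasurable
  exact Measure.isHaarMeasure_eq_of_isProbabilityMeasure _ _

theorem isInvInvariant_of_compactSpace (m : Measure G) [m.IsHaarMeasure]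
    [IsProbabilityMeasure m] : m.IsInvInvariant := by
  have := isMulRightInvariant_of_compactSpace m
  constructor
  have : IsProbabilityMeasure m.inv :=
    Measure.isProbabilityMeasure_map measurable_inv.aemeasurable
  have : m.inv.IsHaarMeasure :=
    Measure.isHaarMeasure_of_isCompact_nonempty_interior m.inv Set.univ isCompact_univ
      (by simp) (by simp) (by simp)
  exact Measure.isHaarMeasure_eq_of_isProbabilityMeasure _ _

variable [TopologicalSpace.MetrizableSpace G]

/-- The left regular representation of `G` on `L²(G)`. -/
noncomputable def leftRegular (m : Measure G) [m.IsHaarMeasure] :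
    Representation ℂ G (Lp ℂ 2 m) where
  toFun g :=
    { toFun := fun f => DomMulAct.mk g⁻¹ • f
      map_add' := fun f f' => smul_add _ f f'
      map_smul' := fun c f => smul_comm _ c f }
  map_one' := by
    ext1 f
    simp
  map_mul' g g' := by
    refine LinearMap.ext fun f => ?_
    simp [mul_smul]

theorem leftRegular_toLp (m : Measure G) [m.IsHaarMeasure] (g : G) {f : G → ℂ}
    (hf : MemLp f 2 m) : leftRegular m g (hf.toLp f) =
      (hf.comp_measurePreserving <| measurePreserving_smul g⁻¹ m).toLp (fun x => f (g⁻¹ * x)) :=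
  rfl

theorem isUnitaryRep_leftRegular (m : Measure G) [m.IsHaarMeasure] [IsProbabilityMeasure m] :
    IsUnitaryRep (leftRegular m) := by
  let _ := TopologicalSpace.metrizableSpaceMetric G
  constructor
  · exact fun g f => DomMulAct.norm_smul_Lp (DomMulAct.mk g⁻¹) f
  · intro f
    have : Fact ((2 : ENNReal) ≠ ⊤) := ⟨by simp⟩
    exact (DomMulAct.continuous_mk.comp continuous_inv).smul continuous_const

theorem inner_leftRegular_toLp (m : Measure G) [m.IsHaarMeasure] (g : G) {f : G → ℂ}
    (hf : MemLp f 2 m) (v : Lp ℂ 2 m) :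
    ⟪leftRegular m g (hf.toLp f), v⟫_ℂ = ∫ x, v x * star (f (g⁻¹ * x)) ∂m := by
  rw [leftRegular_toLp, L2.inner_def]
  refine integral_congr_ae ?_
  filter_upwards [(hf.comp_measurePreserving <| measurePreserving_smul g⁻¹ m).coeFn_toLp] with x hx
  exact congrArg (fun z => ⟪z, v x⟫_ℂ) hx

/-- A mean-zero function is orthogonal to the translation-invariant vectors of `L²(G)`. -/
theorem inner_toLp_eq_zero_of_fixed (m : Measure G) [m.IsHaarMeasure] [IsProbabilityMeasure m]
    [SecondCountableTopology G] {f : G → ℂ} (hfm : Measurable f) {C : ℝ} (hC : ∀ x, ‖f x‖ ≤ C)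
    (hf : MemLp f 2 m) (h0 : ∫ x, f x ∂m = 0) (v : Lp ℂ 2 m)
    (hv : ∀ g, leftRegular m g v = v) : ⟪hf.toLp f, v⟫_ℂ = 0 := by
  have := isMulRightInvariant_of_compactSpace m
  have := isInvInvariant_of_compactSpace m
  have h1 : ∀ g, ⟪hf.toLp f, v⟫_ℂ = ∫ x, v x * star (f (g⁻¹ * x)) ∂m := fun g => by
    rw [← inner_leftRegular_toLp, ← (isUnitaryRep_leftRegular m).inner_map_map g, hv]
  have hvi : Integrable v m := (Lp.memLp v).integrable (by norm_num)
  calc ⟪hf.toLp f, v⟫_ℂ = ∫ g, ∫ x, v x * star (f (g⁻¹ * x)) ∂m ∂m := by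
        simp only [← h1]; simp
    _ = ∫ x, ∫ g, v x * star (f (g⁻¹ * x)) ∂m ∂m := by
        refine integral_integral_swap ?_
        refine (hvi.comp_snd m).mul_bdd (c := C) ?_ ?_
        · exact (Complex.continuous_conj.measurable.comp
            (hfm.comp (measurable_fst.inv.mul measurable_snd))).aestronglyMeasurable
        · exact ae_of_all _ fun p => by simpa using hC _
    _ = ∫ x, v x * star (∫ g, f g ∂m) ∂m := by
        refine integral_congr_ae (ae_of_all _ fun x => ?_)
        change ∫ g, v x * star (f (g⁻¹ * x)) ∂m = _
        rw [integral_const_mul, integral_inv_eq_self (fun g => star (f (g * x))) m,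
          integral_mul_right_eq_self (fun g => star (f g)) x]
        congr 1
        exact integral_conj
    _ = 0 := by simp [h0]

/-- Quasirandomness implies mixing: apply the bound on matrix coefficients to the regular
representation, whose fixed vectors are orthogonal to `b - ∫ b`. -/
theorem IsQuasirandom.isMixing (m : Measure G) [m.IsHaarMeasure] [IsProbabilityMeasure m]
    {D : ℝ} (hD : 0 < D) (hq : IsQuasirandom D G) : IsMixing (1 / √D) m := by
  let _ := TopologicalSpace.metrizableSpaceMetric G
  have := isMulRightInvariant_of_compactSpace m
  have := isInvInvariant_of_compactSpace m
  intro a b ha hb ha1 hb1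
  have hbi := integrable_of_abs_le (μ := m) hb hb1
  have hai := integrable_of_abs_le (μ := m) ha ha1
  set β := ∫ x, b x ∂m with hβ
  have hβ1 : |β| ≤ 1 := abs_integral_le_one hb1
  have hb0m : Measurable fun x => b x - β := hb.sub_const _
  have hb2 : ∀ x, |b x - β| ≤ 2 := fun x => (abs_sub _ _).trans (by linarith [hb1 x])
  let f : G → ℂ := fun x => ((b x - β : ℝ) : ℂ)
  have hfm : Measurable f := Complex.measurable_ofReal.comp hb0m
  have hfC : ∀ x, ‖f x‖ ≤ 2 := fun x => by
    rw [Complex.norm_real]; exact hb2 x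
  have hf : MemLp f 2 m := MemLp.of_bound hfm.aestronglyMeasurable 2 (ae_of_all _ hfC)
  let u : G → ℂ := fun x => (a x : ℂ)
  have hu : MemLp u 2 m :=
    MemLp.of_bound (Complex.measurable_ofReal.comp ha).aestronglyMeasurable 1
      (ae_of_all _ fun x => by rw [Complex.norm_real]; exact ha1 x)
  have h0 : ∫ x, f x ∂m = 0 := by
    simp only [f]
    rw [integral_complex_ofReal, integral_sub hbi (integrable_const _), ← hβ]
    simp
  let w : G → ℝ := fun g => ∫ x, a x * b (g * x) ∂m - (∫ x, a x ∂m) * β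
  have hwm : Measurable w := by
    have : Measurable fun p : G × G => a p.2 * b (p.1 * p.2) :=
      (ha.comp measurable_snd).mul (hb.comp (measurable_fst.mul measurable_snd))
    exact (this.stronglyMeasurable.integral_prod_right (ν := m)).measurable.sub_const _
  have hab : ∀ g, Integrable (fun x => a x * b (g * x)) m := fun g =>
    integrable_of_abs_le (ha.mul (hb.comp (measurable_const_mul g))) (C := 1) fun x => by
      rw [abs_mul]; exact mul_le_one₀ (ha1 x) (abs_nonneg _) (hb1 _)
  have hinner : ∀ g, ⟪leftRegular m g (hf.toLp f), hu.toLp u⟫_ℂ = (w g⁻¹ : ℂ) := by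
    intro g
    rw [inner_leftRegular_toLp]
    have e1 : ∫ x, (hu.toLp u) x * star (f (g⁻¹ * x)) ∂m
        = ∫ x, ((a x * b (g⁻¹ * x) - a x * β : ℝ) : ℂ) ∂m := by
      refine integral_congr_ae ?_
      filter_upwards [hu.coeFn_toLp] with x hx
      rw [hx]
      simp [u, f, mul_sub]
    rw [e1, integral_complex_ofReal, integral_sub (hab _) (hai.mul_const _), integral_mul_const]
  have hwb : ∀ g, |w g| ≤ 2 := by
    intro g
    have h1 : |∫ x, a x * b (g * x) ∂m| ≤ 1 := abs_integral_le_one fun x => by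
      rw [abs_mul]; exact mul_le_one₀ (ha1 x) (abs_nonneg _) (hb1 _)
    have h2 : |(∫ x, a x ∂m) * β| ≤ 1 := by
      rw [abs_mul]; exact mul_le_one₀ (abs_integral_le_one ha1) (abs_nonneg _) hβ1
    exact (abs_sub _ _).trans (by linarith)
  have hnf : ‖hf.toLp f‖ ^ 2 ≤ 1 := by
    rw [norm_sq_toLp_ofReal]
    calc ∫ x, (b x - β) ^ 2 ∂m ≤ ∫ x, (1 - 2 * β * b x + β ^ 2) ∂m := by
          refine integral_mono_of_nonneg (ae_of_all _ fun x => sq_nonneg _)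
            (((integrable_const _).sub (hbi.const_mul _)).add (integrable_const _))
            (ae_of_all _ fun x => ?_)
          have := (sq_le_one_iff_abs_le_one (b x)).2 (hb1 x)
          change (b x - β) ^ 2 ≤ 1 - 2 * β * b x + β ^ 2
          nlinarith
      _ = 1 - 2 * β * β + β ^ 2 := by
          rw [integral_add (by exact (integrable_const _).sub (hbi.const_mul _))
            (integrable_const _), integral_sub (integrable_const _) (hbi.const_mul _),
            integral_const_mul, ← hβ]
          simp
      _ ≤ 1 := by nlinarith [sq_nonneg β]
  have hnu : ‖hu.toLp u‖ ^ 2 ≤ 1 := by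
    rw [norm_sq_toLp_ofReal]
    refine (le_abs_self _).trans (abs_integral_le_one fun x => ?_)
    rw [abs_pow]
    exact pow_le_one₀ (abs_nonneg _) (ha1 x)
  have key := (isUnitaryRep_leftRegular m).integral_norm_inner_sq_le m hq (hf.toLp f)
    (fun v hv => inner_toLp_eq_zero_of_fixed m hfm hfC hf h0 v hv) (hu.toLp u)
  simp only [hinner, Complex.norm_real, Real.norm_eq_abs, sq_abs] at key
  rw [integral_inv_eq_self (fun g => w g ^ 2) m] at key
  have h1 : (∫ g, |w g| ∂m) ^ 2 ≤ 1 / D := by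
    refine (sq_abs_integral_le hwm hwb).trans ?_
    rw [le_div_iff₀ hD, mul_comm]
    exact key.trans (mul_le_one₀ hnf (by positivity) hnu)
  have h2 := Real.abs_le_sqrt h1
  rw [Real.sqrt_div zero_le_one, Real.sqrt_one] at h2
  exact (le_abs_self _).trans h2

end Mixing

/-! ### Conditional expectations on finite partitions and Chu's inequality -/

section FiniteConditionalExpectation

variable {Ω ι : Type*} [MeasurableSpace Ω] {μ : Measure Ω}

/-- `H ∘ π` is the conditional expectation of `f` given the map `π`, which is meant to take finitely
many values: the two functions have the same integral against every function of `π`. -/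
def IsFiberAverage (μ : Measure Ω) (f : Ω → ℝ) (π : Ω → ι) (H : ι → ℝ) : Prop :=
  ∀ w : ι → ℝ, ∫ x, f x * w (π x) ∂μ = ∫ x, H (π x) * w (π x) ∂μ

theorem IsFiberAverage.integral_mul_inv_le_one [IsProbabilityMeasure μ] {f : Ω → ℝ} {π : Ω → ι}
    {H : ι → ℝ} (ha : IsFiberAverage μ f π H) : ∫ x, f x * (H (π x))⁻¹ ∂μ ≤ 1 := by
  have hle : ∀ x, H (π x) * (H (π x))⁻¹ ≤ 1 := fun x => mul_inv_le_one
  have hnn : ∀ x, 0 ≤ H (π x) * (H (π x))⁻¹ := fun x => by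
    by_cases h : H (π x) = 0 <;> simp [h]
  rw [ha fun i => (H i)⁻¹]
  calc ∫ x, H (π x) * (H (π x))⁻¹ ∂μ ≤ ∫ _, (1 : ℝ) ∂μ :=
        integral_mono_of_nonneg (ae_of_all _ hnn) (integrable_const _) (ae_of_all _ hle)
    _ = 1 := by simp

variable [MeasurableSpace ι] [MeasurableSingletonClass ι]

theorem integral_eq_sum_fiber [Fintype ι] {f : Ω → ℝ} (hf : Integrable f μ)
    {π : Ω → ι} (hπ : Measurable π) : ∫ x, f x ∂μ = ∑ i, ∫ x in π ⁻¹' {i}, f x ∂μ := by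
  classical
  have h : ∀ x, f x = ∑ i, (π ⁻¹' {i}).indicator f x := fun x => by
    simp [Set.indicator_apply]
  have hm : ∀ i, MeasurableSet (π ⁻¹' {i}) := fun i => hπ (measurableSet_singleton i)
  calc ∫ x, f x ∂μ = ∫ x, ∑ i, (π ⁻¹' {i}).indicator f x ∂μ := by simp only [← h]
    _ = _ := by
      rw [integral_finsetSum _ fun i _ => hf.indicator (hm i)]
      exact Finset.sum_congr rfl fun i _ => integral_indicator (hm i)

theorem abs_le_sum_of_fintype {ι : Type*} [Fintype ι] (w : ι → ℝ) (i : ι) :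
    |w i| ≤ ∑ j, |w j| :=
  Finset.single_le_sum (f := fun i => |w i|) (fun _ _ => abs_nonneg _) (Finset.mem_univ i)

theorem integrable_mul_comp_finite [Fintype ι] [IsFiniteMeasure μ] {f : Ω → ℝ}
    (hf : Measurable f) {C : ℝ} (hC : ∀ x, |f x| ≤ C) {π : Ω → ι} (hπ : Measurable π)
    (w : ι → ℝ) : Integrable (fun x => f x * w (π x)) μ :=
  (integrable_of_abs_le hf hC).mul_bdd (c := ∑ j, |w j|)
    ((measurable_of_finite w).comp hπ).aestronglyMeasurable
    (ae_of_all _ fun x => abs_le_sum_of_fintype w (π x))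

theorem exists_isFiberAverage [Fintype ι] [IsProbabilityMeasure μ] {f : Ω → ℝ} (hf : Measurable f)
    (h0 : ∀ x, 0 ≤ f x) (h1 : ∀ x, f x ≤ 1) {π : Ω → ι} (hπ : Measurable π) :
    ∃ H : ι → ℝ, (∀ i, 0 ≤ H i) ∧ (∀ i, H i ≤ 1) ∧ IsFiberAverage μ f π H := by
  have hm : ∀ i, MeasurableSet (π ⁻¹' {i}) := fun i => hπ (measurableSet_singleton i)
  have hfi : Integrable f μ := integrable_of_abs_le hf (C := 1) fun x =>
    abs_le.2 ⟨by linarith [h0 x], h1 x⟩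
  have hle : ∀ i, ∫ x in π ⁻¹' {i}, f x ∂μ ≤ μ.real (π ⁻¹' {i}) := fun i => by
    calc ∫ x in π ⁻¹' {i}, f x ∂μ ≤ ∫ _ in π ⁻¹' {i}, (1 : ℝ) ∂μ :=
          integral_mono hfi.integrableOn (integrable_const _) h1
      _ = _ := by simp
  have hnn : ∀ i, 0 ≤ ∫ x in π ⁻¹' {i}, f x ∂μ := fun i => integral_nonneg h0
  let H : ι → ℝ := fun i => (∫ x in π ⁻¹' {i}, f x ∂μ) / μ.real (π ⁻¹' {i})
  have hH0 : ∀ i, 0 ≤ H i := fun i => div_nonneg (hnn i) measureReal_nonneg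
  have hH1 : ∀ i, H i ≤ 1 := fun i => div_le_one_of_le₀ (hle i) measureReal_nonneg
  refine ⟨H, hH0, hH1, fun w => ?_⟩
  have i1 : Integrable (fun x => f x * w (π x)) μ :=
    integrable_mul_comp_finite hf (C := 1) (fun x => abs_le.2 ⟨by linarith [h0 x], h1 x⟩) hπ w
  have i2 : Integrable (fun x => H (π x) * w (π x)) μ :=
    integrable_mul_comp_finite ((measurable_of_finite H).comp hπ) (C := 1)
      (fun x => abs_le.2 ⟨neg_one_lt_zero.le.trans (hH0 _), hH1 _⟩) hπ w
  rw [integral_eq_sum_fiber i1 hπ, integral_eq_sum_fiber i2 hπ]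
  refine Finset.sum_congr rfl fun i _ => ?_
  have e1 : ∫ x in π ⁻¹' {i}, f x * w (π x) ∂μ = (∫ x in π ⁻¹' {i}, f x ∂μ) * w i := by
    rw [← integral_mul_const]
    exact setIntegral_congr_fun (hm i) fun x hx => by
      rw [Set.mem_preimage, Set.mem_singleton_iff] at hx
      simp only [hx]
  have e2 : ∫ x in π ⁻¹' {i}, H (π x) * w (π x) ∂μ = μ.real (π ⁻¹' {i}) * (H i * w i) := by
    rw [← smul_eq_mul (μ.real _), ← setIntegral_const]
    exact setIntegral_congr_fun (hm i) fun x hx => by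
      rw [Set.mem_preimage, Set.mem_singleton_iff] at hx
      simp only [hx]
  rw [e1, e2]
  -- On a null cell the quotient defining `H` is `0 / 0 = 0`, and both sides vanish.
  by_cases hz : μ.real (π ⁻¹' {i}) = 0
  · have : ∫ x in π ⁻¹' {i}, f x ∂μ = 0 := le_antisymm ((hle i).trans hz.le) (hnn i)
    rw [this, hz]; simp
  · simp only [H]
    field_simp

/-- The AM-GM inequality for the four numbers `h₁ h₂ h₃ / δ³`, `δ / h₁`, `δ / h₂`, `δ / h₃`. -/
theorem four_le_of_pos {δ h₁ h₂ h₃ : ℝ} (hδ : 0 < δ) (p₁ : 0 < h₁) (p₂ : 0 < h₂) (p₃ : 0 < h₃) :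
    4 ≤ h₁ * h₂ * h₃ / δ ^ 3 + δ * h₁⁻¹ + δ * h₂⁻¹ + δ * h₃⁻¹ := by
  have hpos : 0 < h₁ * h₂ * h₃ / δ ^ 3 := by positivity
  have h := Real.geom_mean_le_arith_mean4_weighted (w₁ := 1 / 4) (w₂ := 1 / 4) (w₃ := 1 / 4)
    (w₄ := 1 / 4) (by norm_num) (by norm_num) (by norm_num) (by norm_num)
    hpos.le (by positivity : 0 ≤ δ * h₁⁻¹) (by positivity : 0 ≤ δ * h₂⁻¹)
    (by positivity : 0 ≤ δ * h₃⁻¹) (by norm_num)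
  rw [← Real.mul_rpow hpos.le (by positivity), ← Real.mul_rpow (by positivity) (by positivity),
    ← Real.mul_rpow (by positivity) (by positivity),
    show h₁ * h₂ * h₃ / δ ^ 3 * (δ * h₁⁻¹) * (δ * h₂⁻¹) * (δ * h₃⁻¹) = 1 by field_simp,
    Real.one_rpow] at h
  linarith

/-- A nonnegative function vanishes almost everywhere on the cells where its average is zero. -/
theorem IsFiberAverage.ae_eq_zero [Fintype ι] [IsProbabilityMeasure μ] {f : Ω → ℝ}
    (hf : Measurable f) (h0 : ∀ x, 0 ≤ f x) (h1 : ∀ x, f x ≤ 1) {π : Ω → ι} (hπ : Measurable π)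
    {H : ι → ℝ} (ha : IsFiberAverage μ f π H) : ∀ᵐ x ∂μ, H (π x) = 0 → f x = 0 := by
  classical
  have h := ha fun i => if H i = 0 then 1 else 0
  have hz : ∀ x, H (π x) * (if H (π x) = 0 then (1 : ℝ) else 0) = 0 := fun x => by
    by_cases h : H (π x) = 0 <;> simp [h]
  simp only [hz, integral_zero] at h
  rw [integral_eq_zero_iff_of_nonneg
    (fun x => mul_nonneg (h0 x) (by split_ifs <;> simp))
    (integrable_mul_comp_finite hf (C := 1) (fun x => abs_le.2 ⟨by linarith [h0 x], h1 x⟩) hπ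
      fun i => if H i = 0 then 1 else 0)] at h
  filter_upwards [h] with x hx hH
  simpa [hH] using hx

/-- Chu's inequality for three finite conditional expectations of a function `f` with values in
`[0, 1]`. The AM-GM inequality above is multiplied by `f` and integrated; the integral of
`f / E(f | π)` is at most `1`. -/
theorem pow_four_le_integral_fiberAverages [IsProbabilityMeasure μ] {ι₁ ι₂ ι₃ : Type*}
    [Fintype ι₁] [MeasurableSpace ι₁] [MeasurableSingletonClass ι₁]
    [Fintype ι₂] [MeasurableSpace ι₂] [MeasurableSingletonClass ι₂]
    [Fintype ι₃] [MeasurableSpace ι₃] [MeasurableSingletonClass ι₃]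
    {f : Ω → ℝ} (hf : Measurable f) (h0 : ∀ x, 0 ≤ f x) (h1 : ∀ x, f x ≤ 1)
    {π₁ : Ω → ι₁} {π₂ : Ω → ι₂} {π₃ : Ω → ι₃}
    (m₁ : Measurable π₁) (m₂ : Measurable π₂) (m₃ : Measurable π₃)
    {H₁ : ι₁ → ℝ} {H₂ : ι₂ → ℝ} {H₃ : ι₃ → ℝ} 
    (a₁ : IsFiberAverage μ f π₁ H₁) (a₂ : IsFiberAverage μ f π₂ H₂)
    (a₃ : IsFiberAverage μ f π₃ H₃)
    (n₁ : ∀ i, 0 ≤ H₁ i) (n₂ : ∀ i, 0 ≤ H₂ i) (n₃ : ∀ i, 0 ≤ H₃ i) :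
    (∫ x, f x ∂μ) ^ 4 ≤ ∫ x, H₁ (π₁ x) * H₂ (π₂ x) * H₃ (π₃ x) ∂μ := by
  set δ := ∫ x, f x ∂μ with hδdef
  have hδ0 : 0 ≤ δ := integral_nonneg h0
  have hnn : ∀ x, 0 ≤ H₁ (π₁ x) * H₂ (π₂ x) * H₃ (π₃ x) := fun x =>
    mul_nonneg (mul_nonneg (n₁ _) (n₂ _)) (n₃ _)
  rcases hδ0.eq_or_lt with hδ | hδ
  · rw [← hδ]
    simpa using integral_nonneg hnn
  have hf1 : ∀ x, |f x| ≤ 1 := fun x => abs_le.2 ⟨by linarith [h0 x], h1 x⟩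
  have hfi : Integrable f μ := integrable_of_abs_le hf hf1
  have hi : Integrable (fun x => H₁ (π₁ x) * H₂ (π₂ x) * H₃ (π₃ x)) μ := by
    have := integrable_mul_comp_finite (μ := μ) (f := fun _ => 1) (C := 1) measurable_const (by simp)
      (m₁.prodMk (m₂.prodMk m₃)) (fun i => H₁ i.1 * H₂ i.2.1 * H₃ i.2.2)
    simpa using this
  have j₁ := integrable_mul_comp_finite (μ := μ) hf hf1 m₁ fun i => (H₁ i)⁻¹
  have j₂ := integrable_mul_comp_finite (μ := μ) hf hf1 m₂ fun i => (H₂ i)⁻¹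
  have j₃ := integrable_mul_comp_finite (μ := μ) hf hf1 m₃ fun i => (H₃ i)⁻¹
  have hpt : ∀ᵐ x ∂μ, 4 * f x ≤ ((H₁ (π₁ x) * H₂ (π₂ x) * H₃ (π₃ x)) / δ ^ 3
      + δ * (f x * (H₁ (π₁ x))⁻¹)) + (δ * (f x * (H₂ (π₂ x))⁻¹)
      + δ * (f x * (H₃ (π₃ x))⁻¹)) := by
    filter_upwards [a₁.ae_eq_zero hf h0 h1 m₁, a₂.ae_eq_zero hf h0 h1 m₂,
      a₃.ae_eq_zero hf h0 h1 m₃] with x z₁ z₂ z₃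
    -- An average can vanish, and its inverse be meaningless, only where `f` vanishes.
    by_cases hx : f x = 0
    · have := hnn x
      simp only [hx]
      ring_nf
      positivity
    have p₁ := (n₁ (π₁ x)).lt_of_ne' (mt z₁ hx)
    have p₂ := (n₂ (π₂ x)).lt_of_ne' (mt z₂ hx)
    have p₃ := (n₃ (π₃ x)).lt_of_ne' (mt z₃ hx)
    have h4 := mul_le_mul_of_nonneg_left (four_le_of_pos hδ p₁ p₂ p₃) (h0 x)
    have h5 : f x * (H₁ (π₁ x) * H₂ (π₂ x) * H₃ (π₃ x) / δ ^ 3)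
        ≤ H₁ (π₁ x) * H₂ (π₂ x) * H₃ (π₃ x) / δ ^ 3 :=
      mul_le_of_le_one_left (by positivity) (h1 x)
    linarith
  have hint := integral_mono_ae (hfi.const_mul 4)
    (((hi.div_const _).add (j₁.const_mul δ)).add ((j₂.const_mul δ).add (j₃.const_mul δ))) hpt
  rw [integral_const_mul, integral_add' ((hi.div_const _).add (j₁.const_mul δ))
    ((j₂.const_mul δ).add (j₃.const_mul δ)), integral_add' (hi.div_const _) (j₁.const_mul δ),
    integral_add' (j₂.const_mul δ) (j₃.const_mul δ), integral_const_mul, integral_const_mul,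
    integral_const_mul, integral_div] at hint
  have b₁ := mul_le_mul_of_nonneg_left a₁.integral_mul_inv_le_one hδ0
  have b₂ := mul_le_mul_of_nonneg_left a₂.integral_mul_inv_le_one hδ0
  have b₃ := mul_le_mul_of_nonneg_left a₃.integral_mul_inv_le_one hδ0
  have hfin : δ ≤ (∫ x, H₁ (π₁ x) * H₂ (π₂ x) * H₃ (π₃ x) ∂μ) / δ ^ 3 := by linarith
  rw [le_div_iff₀ (by positivity)] at hfin
  calc δ ^ 4 = δ * δ ^ 3 := by ring
    _ ≤ _ := hfin

end FiniteConditionalExpectation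

/-! ### Weak regularity -/

section WeakRegularity

variable {X Y : Type*}

/-- Refinement of a partition into `2 ^ k` cells by the set `A`, partitions being encoded by maps
to `Fin k → Bool`. -/
noncomputable def refineBy {k : ℕ} (p : X → Fin k → Bool) (A : Set X) : X → Fin (k + 1) → Bool :=
  open Classical in fun x => Fin.cons (decide (x ∈ A)) (p x)

theorem tail_refineBy {k : ℕ} (p : X → Fin k → Bool) (A : Set X) (x : X) :
    Fin.tail (refineBy p A x) = p x := by
  simp [refineBy]

theorem indicator_eq_refineBy {k : ℕ} (p : X → Fin k → Bool) (A : Set X) (x : X) :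
    A.indicator (1 : X → ℝ) x = if refineBy p A x 0 then 1 else 0 := by
  classical
  simp [refineBy, Set.indicator_apply]

variable [MeasurableSpace X] [MeasurableSpace Y] {μ : Measure X} {ν : Measure Y}

theorem measurable_refineBy {k : ℕ} {p : X → Fin k → Bool} (hp : Measurable p) {A : Set X}
    (hA : MeasurableSet A) : Measurable (refineBy p A) := by
  classical
  refine measurable_pi_iff.2 fun i => ?_
  refine Fin.cases ?_ (fun i => ?_) i
  · refine measurable_to_bool ?_
    convert hA using 1
    ext x
    simp [refineBy]
  · simpa [refineBy] using measurable_pi_iff.1 hp i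

/-- One step of the energy increment argument: if some rectangle `A × B` detects the difference
between `f` and its average over the cells of a product partition, then refining by `A` and by `B`
increases the energy of the average by at least `η ^ 2`. -/
theorem exists_energy_increment [IsProbabilityMeasure μ] [IsProbabilityMeasure ν]
    {f : X × Y → ℝ} (hf : Measurable f) (h0 : ∀ x, 0 ≤ f x) (h1 : ∀ x, f x ≤ 1) {η : ℝ}
    (hη : 0 < η) {k : ℕ}
    {p : X → Fin k → Bool} {q : Y → Fin k → Bool} (hp : Measurable p) (hq : Measurable q)
    {H : (Fin k → Bool) × (Fin k → Bool) → ℝ} (n0 : ∀ i, 0 ≤ H i) (n1 : ∀ i, H i ≤ 1)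
    (ha : IsFiberAverage (μ.prod ν) f (Prod.map p q) H) {A : Set X} {B : Set Y}
    (hA : MeasurableSet A) (hB : MeasurableSet B)
    (hAB : η < |∫ z, (f z - H (p z.1, q z.2)) * (A.indicator 1 z.1 * B.indicator 1 z.2)
      ∂μ.prod ν|) :
    ∃ H' : (Fin (k + 1) → Bool) × (Fin (k + 1) → Bool) → ℝ, (∀ i, 0 ≤ H' i) ∧ (∀ i, H' i ≤ 1) ∧
      IsFiberAverage (μ.prod ν) f (Prod.map (refineBy p A) (refineBy q B)) H' ∧
      ∫ z, H (p z.1, q z.2) ^ 2 ∂μ.prod ν + η ^ 2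
        ≤ ∫ z, H' (refineBy p A z.1, refineBy q B z.2) ^ 2 ∂μ.prod ν := by
  have hp' := measurable_refineBy hp hA
  have hq' := measurable_refineBy hq hB
  have hπ := hp.prodMap hq
  have hπ' := hp'.prodMap hq'
  obtain ⟨H', n0', n1', ha'⟩ := exists_isFiberAverage (μ := μ.prod ν) hf h0 h1 hπ'
  refine ⟨H', n0', n1', ha', ?_⟩
  let τ : (Fin (k + 1) → Bool) × (Fin (k + 1) → Bool) → (Fin k → Bool) × (Fin k → Bool) :=
    fun i => (Fin.tail i.1, Fin.tail i.2)
  let wAB : (Fin (k + 1) → Bool) × (Fin (k + 1) → Bool) → ℝ :=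
    fun i => (if i.1 0 then 1 else 0) * (if i.2 0 then 1 else 0)
  let h : X × Y → ℝ := fun z => H (p z.1, q z.2)
  let h' : X × Y → ℝ := fun z => H' (refineBy p A z.1, refineBy q B z.2)
  let w : X × Y → ℝ := fun z => A.indicator 1 z.1 * B.indicator 1 z.2
  have hτ : ∀ z, H (τ (Prod.map (refineBy p A) (refineBy q B) z)) = h z := fun z => by
    simp only [τ, h, Prod.map, tail_refineBy]
  have hw : ∀ z, wAB (Prod.map (refineBy p A) (refineBy q B) z) = w z := fun z => by
    simp only [wAB, w, Prod.map, indicator_eq_refineBy p A, indicator_eq_refineBy q B]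
  have hw01 : ∀ z, 0 ≤ w z ∧ w z ≤ 1 := fun z => by
    rw [← hw]; simp only [wAB]; split_ifs <;> norm_num
  have hhm : Measurable h := (measurable_of_finite H).comp hπ
  have hhm' : Measurable h' := (measurable_of_finite H').comp hπ'
  have hwm : Measurable w := by
    have : w = fun z => wAB (Prod.map (refineBy p A) (refineBy q B) z) := funext fun z => (hw z).symm
    rw [this]
    exact (measurable_of_finite wAB).comp hπ'
  have hb : ∀ z, 0 ≤ h z ∧ h z ≤ 1 := fun z => ⟨n0 _, n1 _⟩
  have hb' : ∀ z, 0 ≤ h' z ∧ h' z ≤ 1 := fun z => ⟨n0' _, n1' _⟩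
  have bd : ∀ {u v : X × Y → ℝ}, (∀ z, 0 ≤ u z ∧ u z ≤ 1) → (∀ z, 0 ≤ v z ∧ v z ≤ 1) →
      Measurable u → Measurable v → Integrable (fun z => u z * v z) (μ.prod ν) :=
    fun hu hv mu mv => integrable_of_abs_le (mu.mul mv) (C := 1) fun z => by
      rw [abs_of_nonneg (mul_nonneg (hu z).1 (hv z).1)]
      exact mul_le_one₀ (hu z).2 (hv z).1 (hv z).2
  -- `h` is the average of `h'` over the coarser partition.
  have e1 : ∫ z, h' z * h z ∂μ.prod ν = ∫ z, h z * h z ∂μ.prod ν := by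
    have s1 := ha' fun i => H (τ i)
    have s2 := ha H
    simp only [hτ] at s1
    exact s1.symm.trans s2
  have e2 : ∫ z, f z * w z ∂μ.prod ν = ∫ z, h' z * w z ∂μ.prod ν := by
    have s1 := ha' wAB
    simp only [hw] at s1
    exact s1
  have e3 : ∫ z, (f z - h z) * w z ∂μ.prod ν = ∫ z, (h' z - h z) * w z ∂μ.prod ν := by
    simp only [sub_mul]
    rw [integral_sub (bd (fun z => ⟨h0 z, h1 z⟩) hw01 hf hwm) (bd hb hw01 hhm hwm),
      integral_sub (bd hb' hw01 hhm' hwm) (bd hb hw01 hhm hwm), e2]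
  have hdm : Measurable fun z => (h' z - h z) * w z := (hhm'.sub hhm).mul hwm
  have hd1 : ∀ z, |(h' z - h z)| ≤ 1 := fun z =>
    abs_le.2 ⟨by linarith [(hb z).2, (hb' z).1], by linarith [(hb z).1, (hb' z).2]⟩
  have e4 : (∫ z, (h' z - h z) * w z ∂μ.prod ν) ^ 2 ≤ ∫ z, (h' z - h z) ^ 2 ∂μ.prod ν := by
    refine (sq_integral_le_integral_sq hdm (C := 1) fun z => ?_).trans ?_
    · rw [abs_mul, abs_of_nonneg (hw01 z).1]
      exact mul_le_one₀ (hd1 z) (hw01 z).1 (hw01 z).2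
    · refine integral_mono_of_nonneg (ae_of_all _ fun z => sq_nonneg _)
        (integrable_of_abs_le ((hhm'.sub hhm).pow_const 2) (C := 1) fun z => ?_)
        (ae_of_all _ fun z => ?_)
      · rw [abs_pow]; exact pow_le_one₀ (abs_nonneg _) (hd1 z)
      · change ((h' z - h z) * w z) ^ 2 ≤ _
        rw [mul_pow]
        exact mul_le_of_le_one_right (sq_nonneg _) (pow_le_one₀ (hw01 z).1 (hw01 z).2)
  have e5 : ∫ z, (h' z - h z) ^ 2 ∂μ.prod ν = ∫ z, h' z ^ 2 ∂μ.prod ν - ∫ z, h z ^ 2 ∂μ.prod ν := by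
    have : ∀ z, (h' z - h z) ^ 2 = (h' z * h' z - h' z * h z) - (h' z * h z - h z * h z) :=
      fun z => by ring
    simp only [this, sq]
    rw [integral_sub (by exact (bd hb' hb' hhm' hhm').sub (bd hb' hb hhm' hhm))
      (by exact (bd hb' hb hhm' hhm).sub (bd hb hb hhm hhm)),
      integral_sub (bd hb' hb' hhm' hhm') (bd hb' hb hhm' hhm),
      integral_sub (bd hb' hb hhm' hhm) (bd hb hb hhm hhm), e1]
    ring
  have hη2 : η ^ 2 ≤ (∫ z, (h' z - h z) * w z ∂μ.prod ν) ^ 2 := by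
    rw [← e3, ← sq_abs (∫ z, _ ∂_)]
    exact pow_le_pow_left₀ hη.le hAB.le 2
  change ∫ z, h z ^ 2 ∂μ.prod ν + η ^ 2 ≤ ∫ z, h' z ^ 2 ∂μ.prod ν
  linarith

/-- The weak regularity lemma of Frieze and Kannan: up to an error with cut norm at most `η`, a
function with values in `[0, 1]` agrees with its average over the cells of a product partition with
at most `2 ^ k` cells on each side, where `k` is any integer exceeding `1 / η ^ 2`. -/
theorem exists_weak_regular [IsProbabilityMeasure μ] [IsProbabilityMeasure ν]
    {f : X × Y → ℝ} (hf : Measurable f) (h0 : ∀ x, 0 ≤ f x) (h1 : ∀ x, f x ≤ 1) {η : ℝ}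
    (hη : 0 < η) {k : ℕ} (hk : 1 < k * η ^ 2) :
    ∃ j ≤ k, ∃ (p : X → Fin j → Bool) (q : Y → Fin j → Bool)
      (H : (Fin j → Bool) × (Fin j → Bool) → ℝ), Measurable p ∧ Measurable q ∧
      (∀ i, 0 ≤ H i) ∧ (∀ i, H i ≤ 1) ∧ IsFiberAverage (μ.prod ν) f (Prod.map p q) H ∧
      ∀ (A : Set X) (B : Set Y), MeasurableSet A → MeasurableSet B →
        |∫ z, (f z - H (p z.1, q z.2)) * (A.indicator 1 z.1 * B.indicator 1 z.2) ∂μ.prod ν|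
          ≤ η := by
  by_contra! hcon
  have step : ∀ j ≤ k, ∃ (p : X → Fin j → Bool) (q : Y → Fin j → Bool)
      (H : (Fin j → Bool) × (Fin j → Bool) → ℝ), Measurable p ∧ Measurable q ∧
      (∀ i, 0 ≤ H i) ∧ (∀ i, H i ≤ 1) ∧ IsFiberAverage (μ.prod ν) f (Prod.map p q) H ∧
      j * η ^ 2 ≤ ∫ z, H (p z.1, q z.2) ^ 2 ∂μ.prod ν := by
    intro j
    induction j with
    | zero =>
      intro _
      have hp : Measurable fun _ : X => (Fin.elim0 : Fin 0 → Bool) := measurable_const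
      have hq : Measurable fun _ : Y => (Fin.elim0 : Fin 0 → Bool) := measurable_const
      obtain ⟨H, n0, n1, ha⟩ := exists_isFiberAverage (μ := μ.prod ν) hf h0 h1 (hp.prodMap hq)
      refine ⟨_, _, H, hp, hq, n0, n1, ha, ?_⟩
      rw [Nat.cast_zero, zero_mul]
      exact integral_nonneg fun z => sq_nonneg _
    | succ j ih =>
      intro hj
      obtain ⟨p, q, H, hp, hq, n0, n1, ha, he⟩ := ih (by omega)
      obtain ⟨A, B, hA, hB, hAB⟩ := hcon j (by omega) p q H hp hq n0 n1 ha
      obtain ⟨H', n0', n1', ha', he'⟩ := exists_energy_increment hf h0 h1 hη hp hq n0 n1 ha hA hB hAB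
      refine ⟨_, _, H', measurable_refineBy hp hA, measurable_refineBy hq hB, n0', n1', ha', ?_⟩
      push_cast
      linarith
  obtain ⟨p, q, H, hp, hq, n0, n1, -, he⟩ := step k le_rfl
  have : ∫ z, H (p z.1, q z.2) ^ 2 ∂μ.prod ν ≤ 1 := by
    refine (le_abs_self _).trans (abs_integral_le_one fun z => ?_)
    rw [abs_pow, abs_of_nonneg (n0 _)]
    exact pow_le_one₀ (n0 _) (n1 _)
  linarith

/-- Replacing the weight `a` by the indicator of the set where it is multiplied by something
positive can only increase the integral. -/
theorem exists_measurableSet_integral_le [IsProbabilityMeasure μ] [IsProbabilityMeasure ν]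
    {F : X × Y → ℝ} (hF : Measurable F) {C : ℝ} (hC : ∀ z, |F z| ≤ C) {a : X → ℝ}
    (ha : Measurable a) (a0 : ∀ x, 0 ≤ a x) (a1 : ∀ x, a x ≤ 1) :
    ∃ A : Set X, MeasurableSet A ∧
      ∫ z, F z * a z.1 ∂μ.prod ν ≤ ∫ z, F z * A.indicator 1 z.1 ∂μ.prod ν := by
  let u : X → ℝ := fun x => ∫ y, F (x, y) ∂ν
  have hu : Measurable u := (hF.stronglyMeasurable.integral_prod_right' (ν := ν)).measurable
  have key : ∀ b : X → ℝ, Measurable b → (∀ x, 0 ≤ b x) → (∀ x, b x ≤ 1) →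
      ∫ z, F z * b z.1 ∂μ.prod ν = ∫ x, u x * b x ∂μ ∧ Integrable (fun x => u x * b x) μ := by
    intro b hb b0 b1
    have hi : Integrable (fun z : X × Y => F z * b z.1) (μ.prod ν) :=
      (integrable_of_abs_le hF hC).mul_bdd (c := 1) (hb.comp measurable_fst).aestronglyMeasurable
        (ae_of_all _ fun z => abs_le.2 ⟨by linarith [b0 z.1], b1 z.1⟩)
    have e : ∀ x, ∫ y, F (x, y) * b x ∂ν = u x * b x := fun x => integral_mul_const _ _
    refine ⟨?_, ?_⟩
    · rw [integral_prod _ hi]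
      simp only [e]
    · simpa only [e] using hi.integral_prod_left
  have hA : MeasurableSet {x | 0 < u x} := measurableSet_lt measurable_const hu
  have hind : Measurable ({x | 0 < u x}.indicator (1 : X → ℝ)) := measurable_one.indicator hA
  refine ⟨{x | 0 < u x}, hA, ?_⟩
  obtain ⟨e1, i1⟩ := key a ha a0 a1
  obtain ⟨e2, i2⟩ := key _ hind (fun x => Set.indicator_nonneg (fun _ _ => zero_le_one) x)
    (fun x => Set.indicator_le_self' (fun _ _ => zero_le_one) x)
  rw [e1, e2]
  refine integral_mono i1 i2 fun x => ?_
  by_cases hx : 0 < u x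
  · simpa [hx] using mul_le_of_le_one_right hx.le (a1 x)
  · simpa [hx] using mul_nonpos_of_nonpos_of_nonneg (not_lt.1 hx) (a0 x)

/-- The cut norm may be tested on weights with values in `[0, 1]` instead of on sets. -/
theorem abs_integral_mul_le_of_cut [IsProbabilityMeasure μ] [IsProbabilityMeasure ν]
    {F : X × Y → ℝ} (hF : Measurable F) (hC : ∀ z, |F z| ≤ 1) {η : ℝ}
    (hcut : ∀ (A : Set X) (B : Set Y), MeasurableSet A → MeasurableSet B →
      |∫ z, F z * (A.indicator 1 z.1 * B.indicator 1 z.2) ∂μ.prod ν| ≤ η)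
    {a : X → ℝ} {b : Y → ℝ} (ha : Measurable a) (hb : Measurable b)
    (a0 : ∀ x, 0 ≤ a x) (a1 : ∀ x, a x ≤ 1) (b0 : ∀ y, 0 ≤ b y) (b1 : ∀ y, b y ≤ 1) :
    |∫ z, F z * (a z.1 * b z.2) ∂μ.prod ν| ≤ η := by
  have main : ∀ F : X × Y → ℝ, Measurable F → (∀ z, |F z| ≤ 1) →
      (∀ (A : Set X) (B : Set Y), MeasurableSet A → MeasurableSet B →
        ∫ z, F z * (A.indicator 1 z.1 * B.indicator 1 z.2) ∂μ.prod ν ≤ η) →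
      ∫ z, F z * (a z.1 * b z.2) ∂μ.prod ν ≤ η := by
    clear hcut hC hF F
    intro F hF hC hcut
    obtain ⟨A, hA, hle⟩ := exists_measurableSet_integral_le (μ := μ) (ν := ν)
      (F := fun z => F z * b z.2) (hF.mul (hb.comp measurable_snd)) (C := 1)
      (fun z => by
        rw [abs_mul, abs_of_nonneg (b0 _)]
        exact mul_le_one₀ (hC z) (b0 _) (b1 _)) ha a0 a1
    have hind : Measurable (A.indicator (1 : X → ℝ)) := measurable_one.indicator hA
    have i0 : ∀ x, 0 ≤ A.indicator (1 : X → ℝ) x :=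
      fun x => Set.indicator_nonneg (fun _ _ => zero_le_one) x
    have i1 : ∀ x, A.indicator (1 : X → ℝ) x ≤ 1 :=
      fun x => Set.indicator_le_self' (fun _ _ => zero_le_one) x
    obtain ⟨B, hB, hle'⟩ := exists_measurableSet_integral_le (μ := ν) (ν := μ)
      (F := fun z => F z.swap * A.indicator 1 z.2)
      ((hF.comp measurable_swap).mul (hind.comp measurable_snd)) (C := 1)
      (fun z => by
        rw [abs_mul, abs_of_nonneg (i0 _)]
        exact mul_le_one₀ (hC _) (i0 _) (i1 _)) hb b0 b1
    rw [← integral_prod_swap (μ := ν) (ν := μ), ← integral_prod_swap (μ := ν) (ν := μ)] at hle'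
    calc ∫ z, F z * (a z.1 * b z.2) ∂μ.prod ν = ∫ z, F z * b z.2 * a z.1 ∂μ.prod ν := by
          congr with z; ring
      _ ≤ _ := hle
      _ = _ := by
          congr with z
          simp only [Prod.swap_swap, Prod.snd_swap, Prod.fst_swap]
          ring
      _ ≤ _ := hle'
      _ = ∫ z, F z * (A.indicator 1 z.1 * B.indicator 1 z.2) ∂μ.prod ν := by
          congr with z
          simp only [Prod.swap_swap, Prod.snd_swap, Prod.fst_swap]
          ring
      _ ≤ η := hcut A B hA hB
  refine abs_le.2 ⟨?_, main F hF hC fun A B hA hB => (abs_le.1 (hcut A B hA hB)).2⟩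
  have := main (fun z => - F z) hF.neg (fun z => by rw [abs_neg]; exact hC z) fun A B hA hB => by
    simp only [neg_mul, integral_neg]
    linarith [(abs_le.1 (hcut A B hA hB)).1]
  simp only [neg_mul, integral_neg] at this
  linarith

end WeakRegularity

/-! ### Triangle counts and box norms -/

section ProductIntegrals

variable {X Y Z : Type*} [MeasurableSpace X] [MeasurableSpace Y] [MeasurableSpace Z]
  {μ : Measure X} {ν : Measure Y} {ρ : Measure Z}
  [IsProbabilityMeasure μ] [IsProbabilityMeasure ν] [IsProbabilityMeasure ρ]

theorem integral_prod_rotate (φ : (X × Y) × Z → ℝ) :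
    ∫ t, φ t ∂(μ.prod ν).prod ρ
      = ∫ s : (Y × Z) × X, φ ((s.2, s.1.1), s.1.2) ∂(ν.prod ρ).prod μ := by
  have h1 := (measurePreserving_prodAssoc μ ν ρ).symm.integral_comp' (g := φ)
  have h2 := integral_prod_swap (μ := μ) (ν := ν.prod ρ)
    (fun s : X × Y × Z => φ (MeasurableEquiv.prodAssoc.symm s))
  exact h1.symm.trans h2.symm

theorem integral_prod_exchange (φ : (X × Y) × Z → ℝ) :
    ∫ t, φ t ∂(μ.prod ν).prod ρ
      = ∫ s : (X × Z) × Y, φ ((s.1.1, s.2), s.1.2) ∂(μ.prod ρ).prod ν := by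
  have h : MeasurePreserving
      (MeasurableEquiv.prodComm.prodCongr (MeasurableEquiv.refl Z) : (Y × X) × Z ≃ᵐ (X × Y) × Z)
      ((ν.prod μ).prod ρ) ((μ.prod ν).prod ρ) :=
    Measure.measurePreserving_swap.prod (MeasurePreserving.id ρ)
  exact (h.integral_comp' (g := φ)).symm.trans (integral_prod_rotate _)

/-- The Cauchy–Schwarz inequality that removes a bounded factor not depending on one of the
variables, at the cost of doubling that variable. -/
theorem sq_integral_mul_le {A : X → ℝ} {B : X × Y → ℝ} (hA : Measurable A) (hB : Measurable B)
    (A1 : ∀ x, |A x| ≤ 1) (B1 : ∀ z, |B z| ≤ 1) :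
    (∫ z, A z.1 * B z ∂μ.prod ν) ^ 2
      ≤ ∫ s : X × (Y × Y), B (s.1, s.2.1) * B (s.1, s.2.2) ∂μ.prod (ν.prod ν) := by
  have hAB : Integrable (fun z : X × Y => A z.1 * B z) (μ.prod ν) :=
    integrable_of_abs_le ((hA.comp measurable_fst).mul hB) (C := 1) fun z => by
      rw [abs_mul]; exact mul_le_one₀ (A1 _) (abs_nonneg _) (B1 _)
  have hBm : Measurable fun s : X × (Y × Y) => B (s.1, s.2.1) * B (s.1, s.2.2) := by fun_prop
  have hBB : Integrable (fun s : X × (Y × Y) => B (s.1, s.2.1) * B (s.1, s.2.2))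
      (μ.prod (ν.prod ν)) :=
    integrable_of_abs_le hBm (C := 1) fun z => by
      rw [abs_mul]; exact mul_le_one₀ (B1 _) (abs_nonneg _) (B1 _)
  have hum : Measurable fun x => ∫ y, B (x, y) ∂ν :=
    (hB.stronglyMeasurable.integral_prod_right' (ν := ν)).measurable
  have hu1 : ∀ x, |∫ y, B (x, y) ∂ν| ≤ 1 := fun x => abs_integral_le_one fun y => B1 _
  rw [integral_prod _ hAB, integral_prod _ hBB]
  simp only [integral_const_mul]
  have hprod : ∀ x, ∫ y : Y × Y, B (x, y.1) * B (x, y.2) ∂ν.prod ν = (∫ y, B (x, y) ∂ν) ^ 2 :=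
    fun x => by rw [integral_prod_mul (fun y => B (x, y)) (fun y => B (x, y)), sq]
  simp only [hprod]
  refine (sq_integral_le_integral_sq (f := fun x => A x * ∫ y, B (x, y) ∂ν) (hA.mul hum) (C := 1)
    fun x => ?_).trans ?_
  · rw [abs_mul]; exact mul_le_one₀ (A1 _) (abs_nonneg _) (hu1 _)
  · refine integral_mono_of_nonneg (ae_of_all _ fun z => sq_nonneg _)
      (integrable_of_abs_le (hum.pow_const 2) (C := 1) fun z => ?_) (ae_of_all _ fun z => ?_)
    · rw [abs_pow]; exact pow_le_one₀ (abs_nonneg _) (hu1 z)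
    · change (A z * ∫ y, B (z, y) ∂ν) ^ 2 ≤ _
      rw [mul_pow]
      exact mul_le_of_le_one_left (sq_nonneg _) ((sq_le_one_iff_abs_le_one _).2 (A1 z))

/-- The weighted count of triangles in a tripartite graph with edge weights `A`, `B`, `C`. -/
noncomputable def triangleCount (μ : Measure X) (ν : Measure Y) (ρ : Measure Z) (A : X × Y → ℝ)
    (B : Y × Z → ℝ) (C : Z × X → ℝ) : ℝ :=
  ∫ t : (X × Y) × Z, A (t.1.1, t.1.2) * B (t.1.2, t.2) * C (t.2, t.1.1) ∂(μ.prod ν).prod ρ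

theorem triangleCount_rotate (A : X × Y → ℝ) (B : Y × Z → ℝ) (C : Z × X → ℝ) :
    triangleCount μ ν ρ A B C = triangleCount ν ρ μ B C A := by
  rw [triangleCount, integral_prod_rotate]
  refine integral_congr_ae (ae_of_all _ fun s => ?_)
  change A _ * B _ * C _ = B _ * C _ * A _
  ring

/-- The triangle count changes little when an edge weight is changed by something of small cut
norm. -/
theorem abs_triangleCount_sub_le {A A' : X × Y → ℝ} {B : Y × Z → ℝ} {C : Z × X → ℝ}
    (hA : Measurable A) (hA' : Measurable A') (hB : Measurable B) (hC : Measurable C)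
    (A0 : ∀ z, 0 ≤ A z) (A1 : ∀ z, A z ≤ 1) (A0' : ∀ z, 0 ≤ A' z) (A1' : ∀ z, A' z ≤ 1)
    (B0 : ∀ z, 0 ≤ B z) (B1 : ∀ z, B z ≤ 1) (C0 : ∀ z, 0 ≤ C z) (C1 : ∀ z, C z ≤ 1) {η : ℝ}
    (hcut : ∀ (S : Set X) (T : Set Y), MeasurableSet S → MeasurableSet T →
      |∫ z, (A z - A' z) * (S.indicator 1 z.1 * T.indicator 1 z.2) ∂μ.prod ν| ≤ η) :
    |triangleCount μ ν ρ A B C - triangleCount μ ν ρ A' B C| ≤ η := by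
  have hi : ∀ F : X × Y → ℝ, Measurable F → (∀ z, |F z| ≤ 1) →
      Integrable (fun t : (X × Y) × Z => F (t.1.1, t.1.2) * B (t.1.2, t.2) * C (t.2, t.1.1))
        ((μ.prod ν).prod ρ) := fun F hF F1 =>
    integrable_of_abs_le (by fun_prop) (C := 1) fun t => by
      rw [abs_mul, abs_mul, abs_of_nonneg (B0 _), abs_of_nonneg (C0 _)]
      exact mul_le_one₀ (mul_le_one₀ (F1 _) (B0 _) (B1 _)) (C0 _) (C1 _)
  have d1 : ∀ z, |A z - A' z| ≤ 1 := fun z =>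
    abs_le.2 ⟨by linarith [A0 z, A1' z], by linarith [A1 z, A0' z]⟩
  have e : triangleCount μ ν ρ A B C - triangleCount μ ν ρ A' B C
      = ∫ t : (X × Y) × Z, (A (t.1.1, t.1.2) - A' (t.1.1, t.1.2)) * B (t.1.2, t.2)
        * C (t.2, t.1.1) ∂(μ.prod ν).prod ρ := by
    rw [triangleCount, triangleCount, ← integral_sub
      (hi A hA fun z => abs_le.2 ⟨by linarith [A0 z], A1 z⟩)
      (hi A' hA' fun z => abs_le.2 ⟨by linarith [A0' z], A1' z⟩)]
    congr with t
    ring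
  rw [e, integral_prod_symm _ (hi (fun z => A z - A' z) (hA.sub hA') d1)]
  rw [← Real.norm_eq_abs]
  refine (norm_integral_le_of_norm_le_const (μ := ρ) (C := η) (ae_of_all _ fun z => ?_)).trans_eq
    (by simp)
  have := abs_integral_mul_le_of_cut (hA.sub hA') d1 hcut (a := fun x => C (z, x))
    (b := fun y => B (y, z)) (by fun_prop) (by fun_prop) (fun _ => C0 _) (fun _ => C1 _)
    (fun _ => B0 _) (fun _ => B1 _)
  refine le_trans (le_of_eq ?_) this
  rw [Real.norm_eq_abs]
  congr with w
  simp only [Pi.sub_apply]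
  ring

/-- The Gowers box norm bound: a weight `Θ` on triples correlates with products of functions of two
variables only if its box correlations in two of the variables are not negligible. -/
theorem pow_four_integral_le_box {A : X × Y → ℝ} {B : Y × Z → ℝ} {C : Z × X → ℝ}
    {Θ : (X × Y) × Z → ℝ} (hA : Measurable A) (hB : Measurable B) (hC : Measurable C)
    (hΘ : Measurable Θ) (A1 : ∀ z, |A z| ≤ 1) (B1 : ∀ z, |B z| ≤ 1) (C1 : ∀ z, |C z| ≤ 1)
    (Θ1 : ∀ z, |Θ z| ≤ 1) :
    (∫ t : (X × Y) × Z, A (t.1.1, t.1.2) * B (t.1.2, t.2) * C (t.2, t.1.1) * Θ t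
        ∂(μ.prod ν).prod ρ) ^ 4
      ≤ ∫ s : (Z × Z) × (Y × Y), |∫ x, Θ ((x, s.2.1), s.1.1) * Θ ((x, s.2.1), s.1.2)
        * Θ ((x, s.2.2), s.1.1) * Θ ((x, s.2.2), s.1.2) ∂μ| ∂(ρ.prod ρ).prod (ν.prod ν) := by
  have le1 : ∀ {a b : ℝ}, |a| ≤ 1 → |b| ≤ 1 → |a * b| ≤ 1 := fun ha hb => by
    rw [abs_mul]; exact mul_le_one₀ ha (abs_nonneg _) hb
  let V : (Z × Z) × (Y × Y) → ℝ := fun r =>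
    B (r.2.1, r.1.1) * B (r.2.1, r.1.2) * (B (r.2.2, r.1.1) * B (r.2.2, r.1.2))
  let W : ((Z × Z) × (Y × Y)) × X → ℝ := fun q =>
    Θ ((q.2, q.1.2.1), q.1.1.1) * Θ ((q.2, q.1.2.1), q.1.1.2)
      * Θ ((q.2, q.1.2.2), q.1.1.1) * Θ ((q.2, q.1.2.2), q.1.1.2)
  have hV : Measurable V := by fun_prop
  have hW : Measurable W := by fun_prop
  have V1 : ∀ r, |V r| ≤ 1 := fun r => le1 (le1 (B1 _) (B1 _)) (le1 (B1 _) (B1 _))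
  have W1 : ∀ q, |W q| ≤ 1 := fun q => le1 (le1 (le1 (Θ1 _) (Θ1 _)) (Θ1 _)) (Θ1 _)
  -- The first application of Cauchy–Schwarz removes `A` and doubles `z`.
  have s1 := sq_integral_mul_le (μ := μ.prod ν) (ν := ρ) hA
    (B := fun t : (X × Y) × Z => B (t.1.2, t.2) * C (t.2, t.1.1) * Θ t) (by fun_prop) A1
    fun t => le1 (le1 (B1 _) (C1 _)) (Θ1 _)
  rw [integral_prod_exchange (μ := μ) (ν := ν) (ρ := ρ.prod ρ)] at s1
  -- The second one removes the factors `C` and doubles `y`.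
  have s2 := sq_integral_mul_le (μ := μ.prod (ρ.prod ρ)) (ν := ν)
    (A := fun r => C (r.2.1, r.1) * C (r.2.2, r.1))
    (B := fun r : (X × (Z × Z)) × Y => B (r.2, r.1.2.1) * B (r.2, r.1.2.2)
      * (Θ ((r.1.1, r.2), r.1.2.1) * Θ ((r.1.1, r.2), r.1.2.2)))
    (by fun_prop) (by fun_prop) (fun r => le1 (C1 _) (C1 _))
    fun r => le1 (le1 (B1 _) (B1 _)) (le1 (Θ1 _) (Θ1 _))
  rw [integral_prod_rotate (μ := μ) (ν := ρ.prod ρ) (ρ := ν.prod ν)] at s2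
  calc (∫ t : (X × Y) × Z, A (t.1.1, t.1.2) * B (t.1.2, t.2) * C (t.2, t.1.1) * Θ t
        ∂(μ.prod ν).prod ρ) ^ 4
      = ((∫ t : (X × Y) × Z, A t.1 * (B (t.1.2, t.2) * C (t.2, t.1.1) * Θ t)
        ∂(μ.prod ν).prod ρ) ^ 2) ^ 2 := by
        rw [← pow_mul]
        congr with t
        ring
    _ ≤ _ := pow_le_pow_left₀ (sq_nonneg _) s1 2
    _ = _ := by
        congr with r
        ring
    _ ≤ _ := s2
    _ = ∫ q : ((Z × Z) × (Y × Y)) × X, V q.1 * W q ∂((ρ.prod ρ).prod (ν.prod ν)).prod μ := by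
        congr with q
        ring
    _ = ∫ r, V r * ∫ x, W (r, x) ∂μ ∂(ρ.prod ρ).prod (ν.prod ν) := by
        rw [integral_prod]
        · simp only [integral_const_mul]
        · exact integrable_of_abs_le (by fun_prop) fun q => le1 (V1 _) (W1 _)
    _ ≤ _ := by
        have hWm : Measurable fun r => ∫ x, W (r, x) ∂μ :=
          (hW.stronglyMeasurable.integral_prod_right' (ν := μ)).measurable
        have hW1 : ∀ r, |∫ x, W (r, x) ∂μ| ≤ 1 := fun r => abs_integral_le_one fun x => W1 _
        refine integral_mono (integrable_of_abs_le (hV.mul hWm) fun r => le1 (V1 r) (hW1 r))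
          (integrable_of_abs_le hWm hW1).abs fun r => ?_
        refine (le_abs_self _).trans ?_
        rw [abs_mul]
        exact mul_le_of_le_one_left (abs_nonneg _) (V1 r)

end ProductIntegrals

/-! ### Corner counts on mixing groups -/

section MixingConsequences

/-- The correlation of two translates depends only on the quotient of the translations. -/
theorem integral_abs_correlation {G : Type*} [Group G] [MeasurableSpace G] [MeasurableMul₂ G]
    {m : Measure G} [m.IsMulLeftInvariant] [m.IsMulRightInvariant] (a : G → ℝ) (x : G) :
    ∫ x', |∫ w, a (x * w) * a (x' * w) ∂m| ∂m = ∫ g, |∫ w, a w * a (g * w) ∂m| ∂m := by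
  rw [← integral_mul_right_eq_self (fun g => |∫ w, a w * a (g * w) ∂m|) x⁻¹]
  congr with x'
  rw [← integral_mul_left_eq_self (fun w => a w * a (x' * x⁻¹ * w)) x]
  simp [mul_assoc]

theorem MeasureTheory.MeasurePreserving.integral_comp_measurable {α β : Type*} [MeasurableSpace α]
    [MeasurableSpace β] {μ : Measure α} {ν : Measure β} {Φ : α → β}
    (hΦ : MeasurePreserving Φ μ ν) {f : β → ℝ} (hf : Measurable f) :
    ∫ x, f (Φ x) ∂μ = ∫ y, f y ∂ν := by
  rw [← hΦ.map_eq, integral_map hΦ.measurable.aemeasurable hf.aestronglyMeasurable]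

/-- The weighted count of the corners `(x, y), (g * x, y), (g * x, g * y)` with shift `g`. -/
noncomputable def cornerCount {G : Type*} [Group G] [MeasurableSpace G] (m : Measure G)
    (f : G × G → ℝ) (g : G) : ℝ :=
  ∫ z : G × G, f z * f (g * z.1, z.2) * f (g * z.1, g * z.2) ∂m.prod m

theorem measurable_cornerCount {G : Type*} [Group G] [MeasurableSpace G] [MeasurableMul₂ G]
    {m : Measure G} [SFinite m] {f : G × G → ℝ} (hf : Measurable f) :
    Measurable (cornerCount m f) := by
  have : Measurable fun q : G × (G × G) =>
      f q.2 * f (q.1 * q.2.1, q.2.2) * f (q.1 * q.2.1, q.1 * q.2.2) := by fun_prop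
  exact (this.stronglyMeasurable.integral_prod_right' (ν := m.prod m)).measurable

variable {G : Type*} [Group G] [MeasurableSpace G] [MeasurableMul₂ G] [MeasurableInv G]
  {m : Measure G} [IsProbabilityMeasure m] {κ : ℝ}

/-- Mixing makes the triple `(x, y, x⁻¹ * y)` behave like three independent points, as far as
products of functions of one variable are concerned. -/
theorem IsMixing.abs_integral_mul_mul_sub_le [m.IsInvInvariant] (hκ : IsMixing κ m)
    {a b c : G → ℝ} (ha : Measurable a) (hb : Measurable b) (hc : Measurable c)
    (a1 : ∀ x, |a x| ≤ 1) (b1 : ∀ x, |b x| ≤ 1) (c1 : ∀ x, |c x| ≤ 1) :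
    |∫ z : G × G, a z.1 * b z.2 * c (z.1⁻¹ * z.2) ∂m.prod m
      - (∫ x, a x ∂m) * (∫ x, b x ∂m) * ∫ x, c x ∂m| ≤ κ := by
  have le1 : ∀ {a b : ℝ}, |a| ≤ 1 → |b| ≤ 1 → |a * b| ≤ 1 := fun ha hb => by
    rw [abs_mul]; exact mul_le_one₀ ha (abs_nonneg _) hb
  let w : G → ℝ := fun g => ∫ y, b y * c (g * y) ∂m - (∫ x, b x ∂m) * ∫ x, c x ∂m
  have hwm : Measurable w := by
    have : Measurable fun p : G × G => b p.2 * c (p.1 * p.2) := by fun_prop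
    exact (this.stronglyMeasurable.integral_prod_right' (ν := m)).measurable.sub_const _
  have hw2 : ∀ g, |w g| ≤ 2 := fun g => by
    have h1 : |∫ y, b y * c (g * y) ∂m| ≤ 1 := abs_integral_le_one fun y => le1 (b1 _) (c1 _)
    have h2 := le1 (abs_integral_le_one (μ := m) b1) (abs_integral_le_one (μ := m) c1)
    exact (abs_sub _ _).trans (by linarith)
  have hwi : Integrable (fun x => w x⁻¹) m :=
    integrable_of_abs_le (hwm.comp measurable_inv) fun x => hw2 _
  have haw : Integrable (fun x => a x * w x⁻¹) m :=
    integrable_of_abs_le (ha.mul (hwm.comp measurable_inv)) (C := 1 * 2) fun x => by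
      rw [abs_mul]; exact mul_le_mul (a1 x) (hw2 _) (abs_nonneg _) zero_le_one
  have e : ∫ z : G × G, a z.1 * b z.2 * c (z.1⁻¹ * z.2) ∂m.prod m
      - (∫ x, a x ∂m) * (∫ x, b x ∂m) * ∫ x, c x ∂m = ∫ x, a x * w x⁻¹ ∂m := by
    rw [integral_prod _ (integrable_of_abs_le (by fun_prop) (C := 1)
      fun z => le1 (le1 (a1 _) (b1 _)) (c1 _))]
    simp only [mul_assoc, integral_const_mul]
    have h : ∀ x, ∫ y, b y * c (x⁻¹ * y) ∂m = w x⁻¹ + (∫ x, b x ∂m) * ∫ x, c x ∂m :=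
      fun x => by simp [w]
    simp only [h, mul_add]
    rw [integral_add haw ((integrable_of_abs_le ha a1).mul_const _), integral_mul_const]
    ring
  rw [e]
  calc |∫ x, a x * w x⁻¹ ∂m| ≤ ∫ x, |a x * w x⁻¹| ∂m := abs_integral_le_integral_abs
    _ ≤ ∫ x, |w x⁻¹| ∂m := integral_mono haw.abs hwi.abs fun x => by
        change |a x * w x⁻¹| ≤ |w x⁻¹|
        rw [abs_mul]
        exact mul_le_of_le_one_left (abs_nonneg _) (a1 x)
    _ = ∫ x, |w x| ∂m := integral_inv_eq_self (fun x => |w x|) m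
    _ ≤ κ := hκ b c hb hc b1 c1

/-- Mixing makes the triple `(x, y, x⁻¹ * y)` behave like three independent points, as far as
functions of three finite partitions are concerned, with an error proportional to the number of
cells. -/
theorem IsMixing.abs_integral_finite_sub_le [m.IsInvInvariant] (hκ : IsMixing κ m)
    {ι₁ ι₂ ι₃ : Type*}
    [Fintype ι₁] [MeasurableSpace ι₁] [MeasurableSingletonClass ι₁]
    [Fintype ι₂] [MeasurableSpace ι₂] [MeasurableSingletonClass ι₂]
    [Fintype ι₃] [MeasurableSpace ι₃] [MeasurableSingletonClass ι₃]
    {P : G → ι₁} {Q : G → ι₂} {R : G → ι₃} (hP : Measurable P) (hQ : Measurable Q)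
    (hR : Measurable R) {K : ι₁ × ι₂ × ι₃ → ℝ} (hK : ∀ i, |K i| ≤ 1) :
    |∫ z : G × G, K (P z.1, Q z.2, R (z.1⁻¹ * z.2)) ∂m.prod m
      - ∫ t : (G × G) × G, K (P t.1.1, Q t.1.2, R t.2) ∂(m.prod m).prod m|
      ≤ Fintype.card (ι₁ × ι₂ × ι₃) * κ := by
  classical
  let e₁ : ι₁ → G → ℝ := fun i x => if P x = i then 1 else 0
  let e₂ : ι₂ → G → ℝ := fun i x => if Q x = i then 1 else 0
  let e₃ : ι₃ → G → ℝ := fun i x => if R x = i then 1 else 0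
  have m₁ : ∀ i, Measurable (e₁ i) := fun i =>
    Measurable.ite (hP (measurableSet_singleton i)) measurable_const measurable_const
  have m₂ : ∀ i, Measurable (e₂ i) := fun i =>
    Measurable.ite (hQ (measurableSet_singleton i)) measurable_const measurable_const
  have m₃ : ∀ i, Measurable (e₃ i) := fun i =>
    Measurable.ite (hR (measurableSet_singleton i)) measurable_const measurable_const
  have b₁ : ∀ i x, |e₁ i x| ≤ 1 := fun i x => by simp only [e₁]; split_ifs <;> simp
  have b₂ : ∀ i x, |e₂ i x| ≤ 1 := fun i x => by simp only [e₂]; split_ifs <;> simp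
  have b₃ : ∀ i x, |e₃ i x| ≤ 1 := fun i x => by simp only [e₃]; split_ifs <;> simp
  have hexp : ∀ x y z, K (P x, Q y, R z) = ∑ i, K i * (e₁ i.1 x * e₂ i.2.1 y * e₃ i.2.2 z) := by
    intro x y z
    rw [Finset.sum_eq_single (P x, Q y, R z)]
    · simp [e₁, e₂, e₃]
    · rintro ⟨i, j, l⟩ _ hne
      have : ¬ (P x = i ∧ Q y = j ∧ R z = l) := fun h => hne (by rw [h.1, h.2.1, h.2.2])
      simp only [e₁, e₂, e₃]
      split_ifs <;> simp_all
    · simp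
  have le1 : ∀ {a b : ℝ}, |a| ≤ 1 → |b| ≤ 1 → |a * b| ≤ 1 := fun ha hb => by
    rw [abs_mul]; exact mul_le_one₀ ha (abs_nonneg _) hb
  have i1 : ∀ i : ι₁ × ι₂ × ι₃, Integrable
      (fun z : G × G => K i * (e₁ i.1 z.1 * e₂ i.2.1 z.2 * e₃ i.2.2 (z.1⁻¹ * z.2))) (m.prod m) :=
    fun i => (integrable_of_abs_le (by fun_prop) (C := 1)
      fun z => le1 (le1 (b₁ _ _) (b₂ _ _)) (b₃ _ _)).const_mul _
  have i2 : ∀ i : ι₁ × ι₂ × ι₃, Integrable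
      (fun t : (G × G) × G => K i * (e₁ i.1 t.1.1 * e₂ i.2.1 t.1.2 * e₃ i.2.2 t.2))
      ((m.prod m).prod m) :=
    fun i => (integrable_of_abs_le (by fun_prop) (C := 1)
      fun z => le1 (le1 (b₁ _ _) (b₂ _ _)) (b₃ _ _)).const_mul _
  have hprod : ∀ i : ι₁ × ι₂ × ι₃,
      ∫ t : (G × G) × G, e₁ i.1 t.1.1 * e₂ i.2.1 t.1.2 * e₃ i.2.2 t.2 ∂(m.prod m).prod m
        = (∫ x, e₁ i.1 x ∂m) * (∫ x, e₂ i.2.1 x ∂m) * ∫ x, e₃ i.2.2 x ∂m := fun i => by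
    rw [integral_prod_mul (fun s : G × G => e₁ i.1 s.1 * e₂ i.2.1 s.2) (e₃ i.2.2),
      integral_prod_mul (e₁ i.1) (e₂ i.2.1)]
  simp only [hexp]
  rw [integral_finsetSum _ fun i _ => i1 i, integral_finsetSum _ fun i _ => i2 i,
    ← Finset.sum_sub_distrib]
  refine (Finset.abs_sum_le_sum_abs _ _).trans ?_
  rw [← Finset.card_univ, ← nsmul_eq_mul]
  refine Finset.sum_le_card_nsmul _ _ _ fun i _ => ?_
  rw [integral_const_mul, integral_const_mul, ← mul_sub, abs_mul, hprod]
  exact (mul_le_of_le_one_left (abs_nonneg _) (hK i)).trans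
    (hκ.abs_integral_mul_mul_sub_le (m₁ _) (m₂ _) (m₃ _) (b₁ _) (b₂ _) (b₃ _))

variable [m.IsMulLeftInvariant] [m.IsMulRightInvariant]

/-- The box norm of the weight `φ (x * z * y⁻¹)` is small for a mean-zero function `φ`. -/
theorem IsMixing.integral_box_le [m.IsInvInvariant] (hκ : IsMixing κ m) {φ : G → ℝ}
    (hφ : Measurable φ) (φ1 : ∀ x, |φ x| ≤ 1) (φ0 : ∫ x, φ x ∂m = 0) :
    ∫ s : (G × G) × (G × G), |∫ y, φ (s.1.1 * s.2.1 * y⁻¹) * φ (s.1.2 * s.2.1 * y⁻¹)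
      * φ (s.1.1 * s.2.2 * y⁻¹) * φ (s.1.2 * s.2.2 * y⁻¹) ∂m| ∂(m.prod m).prod (m.prod m)
      ≤ 2 * κ := by
  have le1 : ∀ {a b : ℝ}, |a| ≤ 1 → |b| ≤ 1 → |a * b| ≤ 1 := fun ha hb => by
    rw [abs_mul]; exact mul_le_one₀ ha (abs_nonneg _) hb
  -- For fixed `p = (x, x')` the four factors combine to two translates of
  -- `a w = φ (x * w) * φ (x' * w)`; mixing is applied to `a`, and then to `φ` to bound `∫ a`.
  let W : ((G × G) × (G × G)) × G → ℝ := fun q =>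
    φ (q.1.1.1 * q.1.2.1 * q.2⁻¹) * φ (q.1.1.2 * q.1.2.1 * q.2⁻¹)
      * φ (q.1.1.1 * q.1.2.2 * q.2⁻¹) * φ (q.1.1.2 * q.1.2.2 * q.2⁻¹)
  have hW : Measurable W := by fun_prop
  have W1 : ∀ q, |W q| ≤ 1 := fun q => le1 (le1 (le1 (φ1 _) (φ1 _)) (φ1 _)) (φ1 _)
  have hIm : Measurable fun s => |∫ y, W (s, y) ∂m| :=
    (hW.stronglyMeasurable.integral_prod_right' (ν := m)).measurable.abs
  have hI1 : ∀ s, |(|∫ y, W (s, y) ∂m|)| ≤ 1 := fun s => by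
    rw [abs_abs]; exact abs_integral_le_one fun y => W1 _
  -- Correlation of `φ` with its translates.
  have hcm : Measurable fun p : G × G => |∫ w, φ (p.1 * w) * φ (p.2 * w) ∂m| := by
    have : Measurable fun q : (G × G) × G => φ (q.1.1 * q.2) * φ (q.1.2 * q.2) := by fun_prop
    exact (this.stronglyMeasurable.integral_prod_right' (ν := m)).measurable.abs
  have hc1 : ∀ p : G × G, |(|∫ w, φ (p.1 * w) * φ (p.2 * w) ∂m|)| ≤ 1 := fun p => by
    rw [abs_abs]; exact abs_integral_le_one fun w => le1 (φ1 _) (φ1 _)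
  have hci := integrable_of_abs_le (μ := m.prod m) hcm hc1
  have hcorr : ∫ p : G × G, |∫ w, φ (p.1 * w) * φ (p.2 * w) ∂m| ∂m.prod m ≤ κ := by
    rw [integral_prod _ hci]
    simp only [integral_abs_correlation]
    have := hκ φ φ hφ hφ φ1 φ1
    simpa [φ0] using this
  have hinner : ∀ p : G × G, ∫ r : G × G, |∫ y, W ((p, r), y) ∂m| ∂m.prod m
      ≤ κ + |∫ w, φ (p.1 * w) * φ (p.2 * w) ∂m| := by
    intro p
    let a : G → ℝ := fun w => φ (p.1 * w) * φ (p.2 * w)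
    have ha : Measurable a := by fun_prop
    have a1 : ∀ w, |a w| ≤ 1 := fun w => le1 (φ1 _) (φ1 _)
    have e1 : ∀ z z', ∫ y, W ((p, (z, z')), y) ∂m = ∫ y, a (z * y) * a (z' * y) ∂m := by
      intro z z'
      rw [← integral_inv_eq_self (fun y => a (z * y) * a (z' * y)) m]
      congr with y
      simp only [W, a, mul_assoc]
    have hgm : Measurable fun g => ∫ w, a w * a (g * w) ∂m := by
      have : Measurable fun q : G × G => a q.2 * a (q.1 * q.2) := by fun_prop
      exact (this.stronglyMeasurable.integral_prod_right' (ν := m)).measurable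
    have hg1 : ∀ g, |∫ w, a w * a (g * w) ∂m| ≤ 1 := fun g =>
      abs_integral_le_one fun w => le1 (a1 _) (a1 _)
    have hgi := integrable_of_abs_le (μ := m) hgm hg1
    have hri : Integrable (fun r => |∫ y, W ((p, r), y) ∂m|) (m.prod m) :=
      integrable_of_abs_le (hIm.comp measurable_prodMk_left) fun r => hI1 _
    rw [integral_prod _ hri]
    simp only [e1, integral_abs_correlation, integral_const, probReal_univ, one_smul]
    have hsq : (∫ w, a w ∂m) * ∫ w, a w ∂m ≤ |∫ w, a w ∂m| := by
      rw [← abs_mul_abs_self]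
      exact mul_le_of_le_one_left (abs_nonneg _) (abs_integral_le_one a1)
    calc ∫ g, |∫ w, a w * a (g * w) ∂m| ∂m
        ≤ ∫ g, (|∫ w, a w * a (g * w) ∂m - (∫ w, a w ∂m) * ∫ w, a w ∂m|
            + |∫ w, a w ∂m|) ∂m := by
          refine integral_mono hgi.abs ((hgi.sub (integrable_const _)).abs.add
            (integrable_const _)) fun g => ?_
          have := abs_add_le (∫ w, a w * a (g * w) ∂m - (∫ w, a w ∂m) * ∫ w, a w ∂m)
            ((∫ w, a w ∂m) * ∫ w, a w ∂m)
          rw [sub_add_cancel, abs_of_nonneg (mul_self_nonneg (∫ w, a w ∂m))] at this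
          exact this.trans (by gcongr)
      _ = ∫ g, |∫ w, a w * a (g * w) ∂m - (∫ w, a w ∂m) * ∫ w, a w ∂m| ∂m
            + |∫ w, a w ∂m| := by
          rw [integral_add (by exact (hgi.sub (integrable_const _)).abs) (integrable_const _)]
          simp
      _ ≤ _ := by
          gcongr
          exact hκ a a ha ha a1 a1
  change ∫ s, |∫ y, W (s, y) ∂m| ∂(m.prod m).prod (m.prod m) ≤ 2 * κ
  have hIi := integrable_of_abs_le (μ := (m.prod m).prod (m.prod m)) hIm hI1
  rw [integral_prod _ hIi]
  calc ∫ p, ∫ r, |∫ y, W ((p, r), y) ∂m| ∂m.prod m ∂m.prod m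
      ≤ ∫ p : G × G, (κ + |∫ w, φ (p.1 * w) * φ (p.2 * w) ∂m|) ∂m.prod m :=
        integral_mono hIi.integral_prod_left ((integrable_const _).add hci) hinner
    _ = κ + ∫ p : G × G, |∫ w, φ (p.1 * w) * φ (p.2 * w) ∂m| ∂m.prod m := by
        rw [integral_add (integrable_const _) hci]
        simp
    _ ≤ 2 * κ := by linarith

/-- The change of variables from triangles to corners: the triangle with vertices `y`, `z`, `x'`,
encoded as `((y, z), x')`, corresponds to the corner `(x, y), (g * x, y), (g * x, g * y)` with
`x = y * z⁻¹` and `g * x = x'`, encoded as `((x, y), g)`. -/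
theorem measurePreserving_corner [m.IsInvInvariant] : MeasurePreserving
    (fun t : (G × G) × G => ((t.1.1 * t.1.2⁻¹, t.1.1), t.2 * t.1.2 * t.1.1⁻¹))
    ((m.prod m).prod m) ((m.prod m).prod m) := by
  have h1 : MeasurePreserving (fun p : G × G => (p.1 * p.2⁻¹, p.1)) (m.prod m) (m.prod m) :=
    Measure.measurePreserving_swap.comp ((measurePreserving_prod_mul m m).comp
      ((MeasurePreserving.id m).prod (Measure.measurePreserving_inv m)))
  refine h1.skew_product (g := fun p x => x * p.2 * p.1⁻¹) (by fun_prop) (ae_of_all _ fun p => ?_)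
  have := ((measurePreserving_mul_right m p.1⁻¹).comp (measurePreserving_mul_right m p.2)).map_eq
  exact this

/-- The corner counts, weighted by a function of the shift, as a weighted triangle count. -/
theorem integral_mul_cornerCount [m.IsInvInvariant] {f : G × G → ℝ} (hf : Measurable f)
    (f1 : ∀ z, |f z| ≤ 1) {φ : G → ℝ} (hφ : Measurable φ) (φ1 : ∀ x, |φ x| ≤ 1) :
    ∫ g, φ g * cornerCount m f g ∂m = ∫ t : (G × G) × G, f (t.1.1 * t.1.2⁻¹, t.1.1)
      * f (t.2, t.2 * t.1.2) * f (t.2, t.1.1) * φ (t.2 * t.1.2 * t.1.1⁻¹)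
      ∂(m.prod m).prod m := by
  have le1 : ∀ {a b : ℝ}, |a| ≤ 1 → |b| ≤ 1 → |a * b| ≤ 1 := fun ha hb => by
    rw [abs_mul]; exact mul_le_one₀ ha (abs_nonneg _) hb
  let F : (G × G) × G → ℝ := fun s =>
    φ s.2 * (f s.1 * f (s.2 * s.1.1, s.1.2) * f (s.2 * s.1.1, s.2 * s.1.2))
  have hF : Measurable F := by fun_prop
  have F1 : ∀ s, |F s| ≤ 1 := fun s => le1 (φ1 _) (le1 (le1 (f1 _) (f1 _)) (f1 _))
  calc ∫ g, φ g * cornerCount m f g ∂m = ∫ s, F s ∂(m.prod m).prod m := by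
        rw [integral_prod_symm _ (integrable_of_abs_le hF F1)]
        simp only [F, integral_const_mul, cornerCount]
    _ = _ := by
        rw [← measurePreserving_corner.integral_comp_measurable hF]
        congr with t
        simp only [F]
        simp [mul_assoc]
        ring

/-- The corner counts for different shifts hardly fluctuate. -/
theorem IsMixing.pow_four_integral_mul_cornerCount_le [m.IsInvInvariant] (hκ : IsMixing κ m)
    {f : G × G → ℝ} (hf : Measurable f) (f1 : ∀ z, |f z| ≤ 1) {φ : G → ℝ} (hφ : Measurable φ)
    (φ1 : ∀ x, |φ x| ≤ 1) (φ0 : ∫ x, φ x ∂m = 0) :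
    (∫ g, φ g * cornerCount m f g ∂m) ^ 4 ≤ 2 * κ := by
  rw [integral_mul_cornerCount hf f1 hφ φ1]
  exact (pow_four_integral_le_box (A := fun p : G × G => f (p.1 * p.2⁻¹, p.1))
    (B := fun p : G × G => f (p.2, p.2 * p.1)) (C := f)
    (Θ := fun t : (G × G) × G => φ (t.2 * t.1.2 * t.1.1⁻¹)) (by fun_prop) (by fun_prop) hf
    (by fun_prop) (fun _ => f1 _) (fun _ => f1 _) f1 (fun _ => φ1 _)).trans
    (hκ.integral_box_le hφ φ1 φ0)

end MixingConsequences

/-! ### The mean corner count -/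

section CornerCount

theorem IsFiberAverage.comp_measurePreserving {Ω Ω' ι : Type*} [MeasurableSpace Ω]
    [MeasurableSpace Ω'] [Finite ι] [MeasurableSpace ι] [MeasurableSingletonClass ι]
    {μ : Measure Ω} {μ' : Measure Ω'} {Φ : Ω → Ω'} (hΦ : MeasurePreserving Φ μ μ') {f : Ω' → ℝ}
    (hf : Measurable f) {π : Ω' → ι} (hπ : Measurable π) {H : ι → ℝ}
    (ha : IsFiberAverage μ' f π H) : IsFiberAverage μ (f ∘ Φ) (π ∘ Φ) H := by
  intro w
  have hw : Measurable fun x => w (π x) := (measurable_of_finite w).comp hπ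
  have hH : Measurable fun x => H (π x) := (measurable_of_finite H).comp hπ
  have e1 := hΦ.integral_comp_measurable (hf.mul hw)
  have e2 := hΦ.integral_comp_measurable (hH.mul hw)
  exact e1.trans ((ha w).trans e2.symm)

theorem IsMixing.nonneg {G : Type*} [Group G] [MeasurableSpace G] {m : Measure G}
    {κ : ℝ} (hκ : IsMixing κ m) : 0 ≤ κ :=
  (integral_nonneg fun _ => abs_nonneg _).trans
    (hκ 0 0 measurable_zero measurable_zero (by simp) (by simp))

variable {G : Type*} [Group G] [MeasurableSpace G] [MeasurableMul₂ G] [MeasurableInv G]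
  {m : Measure G} [IsProbabilityMeasure m] {κ : ℝ}

variable [m.IsMulLeftInvariant] [m.IsMulRightInvariant] [m.IsInvInvariant]

/-- The mean of the corner counts is at least `(∫ f) ^ 4` up to a small error.

In the coordinates `g * x`, `y` and `z = x⁻¹ * y` a corner is a triangle whose edge weights are
`f` written as a function of two of the coordinates. Weak regularity replaces each weight by its
average over a finite partition, mixing allows `z` to be tied to the other two coordinates, and
then the three averages are conditional expectations of one and the same function, to which Chu's
inequality applies. -/
theorem IsMixing.le_integral_cornerCount (hκ : IsMixing κ m) {f : G × G → ℝ} (hf : Measurable f)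
    (f0 : ∀ z, 0 ≤ f z) (f1 : ∀ z, f z ≤ 1) {η : ℝ} (hη : 0 < η) {k : ℕ} (hk : 1 < k * η ^ 2) :
    (∫ z, f z ∂m.prod m) ^ 4 - 3 * η - 2 ^ (6 * k) * κ ≤ ∫ g, cornerCount m f g ∂m := by
  let A : G × G → ℝ := fun p => f (p.1 * p.2⁻¹, p.1)
  let B : G × G → ℝ := fun p => f (p.2, p.2 * p.1)
  have hA : Measurable A := by fun_prop
  have hB : Measurable B := by fun_prop
  obtain ⟨jA, jAk, pA, qA, HA, mpA, mqA, HA0, HA1, avA, cutA⟩ :=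
    exists_weak_regular (μ := m) (ν := m) hA (fun _ => f0 _) (fun _ => f1 _) hη hk
  obtain ⟨jB, jBk, pB, qB, HB, mpB, mqB, HB0, HB1, avB, cutB⟩ :=
    exists_weak_regular (μ := m) (ν := m) hB (fun _ => f0 _) (fun _ => f1 _) hη hk
  obtain ⟨jC, jCk, pC, qC, HC, mpC, mqC, HC0, HC1, avC, cutC⟩ :=
    exists_weak_regular (μ := m) (ν := m) hf f0 f1 hη hk
  let A' : G × G → ℝ := fun z => HA (pA z.1, qA z.2)
  let B' : G × G → ℝ := fun z => HB (pB z.1, qB z.2)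
  let C' : G × G → ℝ := fun z => HC (pC z.1, qC z.2)
  have hA' : Measurable A' := (measurable_of_finite HA).comp (mpA.prodMap mqA)
  have hB' : Measurable B' := (measurable_of_finite HB).comp (mpB.prodMap mqB)
  have hC' : Measurable C' := (measurable_of_finite HC).comp (mpC.prodMap mqC)
  have hmean : ∫ g, cornerCount m f g ∂m = triangleCount m m m A B f := by
    have := integral_mul_cornerCount (m := m) hf
      (fun z => abs_le.2 ⟨by linarith [f0 z], f1 z⟩) (φ := fun _ => 1) measurable_const (by simp)
    simp only [one_mul, mul_one] at this
    exact this
  have r1 : |triangleCount m m m A B f - triangleCount m m m A' B f| ≤ η :=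
    abs_triangleCount_sub_le hA hA' hB hf (fun _ => f0 _) (fun _ => f1 _) (fun _ => HA0 _)
      (fun _ => HA1 _) (fun _ => f0 _) (fun _ => f1 _) f0 f1 cutA
  have r2 : |triangleCount m m m B f A' - triangleCount m m m B' f A'| ≤ η :=
    abs_triangleCount_sub_le hB hB' hf hA' (fun _ => f0 _) (fun _ => f1 _) (fun _ => HB0 _)
      (fun _ => HB1 _) f0 f1 (fun _ => HA0 _) (fun _ => HA1 _) cutB
  have r3 : |triangleCount m m m f A' B' - triangleCount m m m C' A' B'| ≤ η :=
    abs_triangleCount_sub_le hf hC' hA' hB' f0 f1 (fun _ => HC0 _)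
      (fun _ => HC1 _) (fun _ => HA0 _) (fun _ => HA1 _) (fun _ => HB0 _) (fun _ => HB1 _) cutC
  have t1 := triangleCount_rotate (μ := m) (ν := m) (ρ := m) A' B f
  have t2 := triangleCount_rotate (μ := m) (ν := m) (ρ := m) B' f A'
  -- Both `A` and `B` are `f` in other coordinates.
  have hΦ : MeasurePreserving (fun p : G × G => (p.1, p.1⁻¹ * p.2)) (m.prod m) (m.prod m) :=
    measurePreserving_prod_inv_mul m m
  have hΦB : MeasurePreserving (fun p : G × G => (p.1⁻¹ * p.2, p.1)) (m.prod m) (m.prod m) :=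
    Measure.measurePreserving_swap.comp hΦ
  have hΦA : MeasurePreserving (fun p : G × G => (p.2, p.1⁻¹ * p.2)) (m.prod m) (m.prod m) := by
    have := ((MeasurePreserving.id m).prod (Measure.measurePreserving_inv m)).comp
      (hΦ.comp (Measure.measurePreserving_swap (μ := m) (ν := m)))
    convert this using 1
    ext p <;> simp
  have avA' := avA.comp_measurePreserving hΦA hA (mpA.prodMap mqA)
  have avB' := avB.comp_measurePreserving hΦB hB (mpB.prodMap mqB)
  have eA : A ∘ (fun p : G × G => (p.2, p.1⁻¹ * p.2)) = f := by
    funext p; simp [A]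
  have eB : B ∘ (fun p : G × G => (p.1⁻¹ * p.2, p.1)) = f := by
    funext p; simp [B]
  rw [eA] at avA'
  rw [eB] at avB'
  have chu := pow_four_le_integral_fiberAverages hf f0 f1
    (mpC.prodMap mqC) ((mpA.prodMap mqA).comp hΦA.measurable)
    ((mpB.prodMap mqB).comp hΦB.measurable) avC avA' avB' HC0 HA0 HB0
  let K : ((Fin jB → Bool) × (Fin jC → Bool)) × ((Fin jA → Bool) × (Fin jC → Bool)) ×
      ((Fin jA → Bool) × (Fin jB → Bool)) → ℝ := fun i =>
    HC (i.1.2, i.2.1.2) * HA (i.2.1.1, i.2.2.1) * HB (i.2.2.2, i.1.1)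
  have hK : ∀ i, |K i| ≤ 1 := fun i => by
    rw [abs_of_nonneg (mul_nonneg (mul_nonneg (HC0 _) (HA0 _)) (HB0 _))]
    exact mul_le_one₀ (mul_le_one₀ (HC1 _) (HA0 _) (HA1 _)) (HB0 _) (HB1 _)
  have fin := hκ.abs_integral_finite_sub_le (mqB.prodMk mpC) (mpA.prodMk mqC) (mqA.prodMk mpB) hK
  have hcard : (Fintype.card (((Fin jB → Bool) × (Fin jC → Bool)) ×
      ((Fin jA → Bool) × (Fin jC → Bool)) × ((Fin jA → Bool) × (Fin jB → Bool))) : ℝ)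
      ≤ 2 ^ (6 * k) := by
    simp only [Fintype.card_prod, Fintype.card_fun, Fintype.card_fin, Fintype.card_bool]
    rw [← pow_add, ← pow_add, ← pow_add, ← pow_add, ← pow_add]
    push_cast
    exact pow_le_pow_right₀ (by norm_num) (by omega)
  have hcard' := mul_le_mul_of_nonneg_right hcard hκ.nonneg
  change (∫ z, f z ∂m.prod m) ^ 4 ≤ ∫ z : G × G, K ((qB z.1, pC z.1), (pA z.2, qC z.2),
    (qA (z.1⁻¹ * z.2), pB (z.1⁻¹ * z.2))) ∂m.prod m at chu
  change |_ - triangleCount m m m C' A' B'| ≤ _ at fin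
  have q1 := abs_le.1 r1
  have q2 := abs_le.1 r2
  have q3 := abs_le.1 r3
  have q4 := abs_le.1 fin
  linarith [q1.1, q2.1, q3.1, q4.2]

end CornerCount

/-! ### Popular shifts -/

section PopularShifts

theorem cornerCount_indicator {G : Type*} [Group G] [MeasurableSpace G] [MeasurableMul₂ G]
    (m : Measure G) {E : Set (G × G)} (hE : MeasurableSet E) (g : G) :
    cornerCount m (E.indicator 1) g = (m.prod m).real (bmzCorners E g) := by
  have hset : bmzCorners E g = E ∩ ((fun p : G × G => (g * p.1, p.2)) ⁻¹' E ∩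
      (fun p : G × G => (g * p.1, g * p.2)) ⁻¹' E) := by
    ext p
    simp only [bmzCorners, Set.insert_subset_iff, Set.singleton_subset_iff]
    rfl
  have hm : MeasurableSet (bmzCorners E g) := by
    rw [hset]
    exact hE.inter (((by fun_prop : Measurable fun p : G × G => (g * p.1, p.2)) hE).inter
      ((by fun_prop : Measurable fun p : G × G => (g * p.1, g * p.2)) hE))
  rw [← integral_indicator_one hm, cornerCount]
  congr with p
  by_cases h1 : p ∈ E <;> by_cases h2 : (g * p.1, p.2) ∈ E <;>
    by_cases h3 : (g * p.1, g * p.2) ∈ E <;> simp [hset, h1, h2, h3]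

/-- If the mean of the corner counts is not much less than `δ ^ 4`, then few shifts can have a corner
count below `δ ^ 4 - ε`: the counts would correlate with the indicator of the set of such shifts. -/
theorem IsMixing.measure_cornerCount_lt_le {G : Type*} [Group G] [MeasurableSpace G]
    [MeasurableMul₂ G] [MeasurableInv G] {m : Measure G} [IsProbabilityMeasure m]
    [m.IsMulLeftInvariant] [m.IsMulRightInvariant] [m.IsInvInvariant] {κ ε c : ℝ}
    (hκ : IsMixing κ m) (hε : 0 < ε) (hκε : 32 * κ < ε ^ 8) {f : G × G → ℝ} (hf : Measurable f)
    (f1 : ∀ z, |f z| ≤ 1) (hmean : c - ε / 2 ≤ ∫ g, cornerCount m f g ∂m) :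
    m.real {g | cornerCount m f g < c - ε} ≤ ε := by
  by_contra! hlt
  set S := {g | cornerCount m f g < c - ε} with hSdef
  have hcm := measurable_cornerCount (m := m) hf
  have hS : MeasurableSet S := measurableSet_lt hcm measurable_const
  set σ := m.real S with hσ
  have hσ1 : σ ≤ 1 := measureReal_le_one
  have hσ0 : 0 ≤ σ := measureReal_nonneg
  have le1 : ∀ {a b : ℝ}, |a| ≤ 1 → |b| ≤ 1 → |a * b| ≤ 1 := fun ha hb => by
    rw [abs_mul]; exact mul_le_one₀ ha (abs_nonneg _) hb
  have hc1 : ∀ g, |cornerCount m f g| ≤ 1 := fun g =>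
    abs_integral_le_one fun z => le1 (le1 (f1 _) (f1 _)) (f1 _)
  have hci := integrable_of_abs_le (μ := m) hcm hc1
  have hind : Measurable (S.indicator (1 : G → ℝ)) := measurable_one.indicator hS
  let φ : G → ℝ := fun g => S.indicator 1 g - σ
  have hφ : Measurable φ := hind.sub_const _
  have φ1 : ∀ g, |φ g| ≤ 1 := fun g => by
    by_cases hg : g ∈ S
    · simp only [φ, Set.indicator_of_mem hg, Pi.one_apply]
      exact abs_le.2 ⟨by linarith, by linarith⟩
    · simp only [φ, Set.indicator_of_notMem hg]
      exact abs_le.2 ⟨by linarith, by linarith⟩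
  have hindi : Integrable (S.indicator (1 : G → ℝ)) m := (integrable_const (1 : ℝ)).indicator hS
  have φ0 : ∫ g, φ g ∂m = 0 := by
    rw [integral_sub hindi (integrable_const _), integral_indicator_one hS]
    simp [hσ]
  have hcorr := hκ.pow_four_integral_mul_cornerCount_le hf f1 hφ φ1 φ0
  have hSc : ∫ g, S.indicator 1 g * cornerCount m f g ∂m ≤ σ * (c - ε) := by
    have e : ∀ g, S.indicator 1 g * cornerCount m f g = S.indicator (cornerCount m f) g := fun g => by
      by_cases hg : g ∈ S <;> simp [hg]
    simp only [e]
    rw [integral_indicator hS]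
    calc ∫ g in S, cornerCount m f g ∂m ≤ ∫ _ in S, (c - ε) ∂m :=
          setIntegral_mono_on hci.integrableOn (integrable_const _).integrableOn hS
            fun g hg => le_of_lt hg
      _ = σ * (c - ε) := by rw [setIntegral_const, smul_eq_mul]
  have hle : ∫ g, φ g * cornerCount m f g ∂m ≤ - (σ * (ε / 2)) := by
    simp only [φ, sub_mul]
    rw [integral_sub (integrable_of_abs_le (by exact hind.mul hcm) (C := 1) fun g => le1
      (by by_cases hg : g ∈ S <;> simp [hg]) (hc1 g)) (hci.const_mul _), integral_const_mul]
    nlinarith [mul_le_mul_of_nonneg_left hmean hσ0]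
  -- The correlation of the counts with `φ` is too negative for the fluctuation bound.
  have h4 : (ε * (ε / 2)) ^ 4 ≤ (∫ g, φ g * cornerCount m f g ∂m) ^ 4 := by
    rw [← Even.neg_pow (by decide : Even 4) (∫ g, _ ∂m)]
    refine pow_le_pow_left₀ (by positivity) ?_ 4
    have : ε * (ε / 2) ≤ σ * (ε / 2) := by gcongr
    linarith
  have : (ε * (ε / 2)) ^ 4 = ε ^ 8 / 16 := by ring
  linarith

/-- The choice of constants: `η = ε / 12` in the weak regularity lemma and `k` just above
`1 / η ^ 2`, with mixing parameter `κ = 1 / √D`. -/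
theorem exists_parameters {ε : ℝ} (hε : 0 < ε) (hε2 : ε < 1 / 2) :
    ∃ k : ℕ, 1 < k * (ε / 12) ^ 2 ∧
      2 ^ (6 * k) * (1 / √(Real.exp ((1 / ε) ^ (20 : ℝ)))) ≤ ε / 4 ∧
      32 * (1 / √(Real.exp ((1 / ε) ^ (20 : ℝ)))) < ε ^ 8 := by
  obtain ⟨t, ht, rfl⟩ : ∃ t : ℝ, 2 < t ∧ ε = 1 / t :=
    ⟨1 / ε, by rw [lt_div_iff₀ hε]; linarith, by simp⟩
  have ht0 : 0 < t := by linarith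
  have hexp : √(Real.exp ((1 / (1 / t)) ^ (20 : ℝ))) = Real.exp (t ^ 20 / 2) := by
    rw [one_div_one_div, ← Real.exp_half]
    norm_num
  have hbig : 262144 * t ^ 2 ≤ t ^ 20 := by
    have : (2 : ℝ) ^ 18 ≤ t ^ 18 := pow_le_pow_left₀ (by norm_num) ht.le 18
    calc 262144 * t ^ 2 = 2 ^ 18 * t ^ 2 := by norm_num
      _ ≤ t ^ 18 * t ^ 2 := by gcongr
      _ = t ^ 20 := by ring
  have hte : t ≤ Real.exp t := by linarith [Real.add_one_le_exp t]
  have h2e : (2 : ℝ) ≤ Real.exp 1 := by linarith [Real.add_one_le_exp (1 : ℝ)]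
  have h2e' : ∀ n : ℕ, (2 : ℝ) ^ n ≤ Real.exp n := fun n => by
    rw [← mul_one (n : ℝ), Real.exp_nat_mul]
    exact pow_le_pow_left₀ (by norm_num) h2e n
  rw [hexp]
  refine ⟨⌈144 * t ^ 2⌉₊ + 1, ?_, ?_, ?_⟩
  · have := Nat.le_ceil (144 * t ^ 2)
    rw [show (1 / t / 12) ^ 2 = 1 / (144 * t ^ 2) by field_simp; norm_num, mul_one_div,
      lt_div_iff₀ (by positivity)]
    push_cast
    linarith
  · have hk : ((⌈144 * t ^ 2⌉₊ + 1 : ℕ) : ℝ) ≤ 144 * t ^ 2 + 2 := by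
      push_cast
      linarith [Nat.ceil_lt_add_one (by positivity : 0 ≤ 144 * t ^ 2)]
    rw [mul_one_div, div_le_div_iff₀ (Real.exp_pos _) (by norm_num), div_mul_eq_mul_div, one_mul,
      le_div_iff₀ ht0]
    calc 2 ^ (6 * (⌈144 * t ^ 2⌉₊ + 1)) * 4 * t
        ≤ Real.exp ((6 * (⌈144 * t ^ 2⌉₊ + 1) : ℕ)) * Real.exp (2 : ℕ) * Real.exp t := by
          gcongr
          · exact h2e' _
          · exact le_trans (by norm_num) (h2e' 2)
      _ = Real.exp (6 * ((⌈144 * t ^ 2⌉₊ + 1 : ℕ) : ℝ) + 2 + t) := by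
          rw [← Real.exp_add, ← Real.exp_add]
          push_cast
          rfl
      _ ≤ Real.exp (t ^ 20 / 2) := by
          apply Real.exp_le_exp.2
          nlinarith
  · rw [mul_one_div, div_lt_iff₀ (Real.exp_pos _), one_div, inv_pow, inv_mul_eq_div,
      lt_div_iff₀ (by positivity)]
    calc 32 * t ^ 8 ≤ Real.exp (5 : ℕ) * Real.exp t ^ 8 := by
          gcongr
          exact le_trans (by norm_num) (h2e' 5)
      _ = Real.exp (5 + 8 * t) := by
          rw [← Real.exp_nat_mul, ← Real.exp_add]
          norm_num
      _ < Real.exp (t ^ 20 / 2) := by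
          apply Real.exp_lt_exp.2
          nlinarith

end PopularShifts

theorem theoremC :
    ∃ C : ℝ, 0 < C ∧ ∀ ε : ℝ, 0 < ε → ε < 1 / 2 →
      ∃ D : ℝ, D = Real.exp ((1 / ε) ^ C) ∧
        ∀ (G : Type*) [Group G] [TopologicalSpace G] [IsTopologicalGroup G] [CompactSpace G]
          [TopologicalSpace.MetrizableSpace G] [MeasurableSpace G] [BorelSpace G]
          (m : Measure G) [m.IsHaarMeasure] [IsProbabilityMeasure m],
          IsQuasirandom D G →
          ∀ E : Set (G × G), MeasurableSet[borel (G × G)] E →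
            MeasurableSet {g : G |
              (m.prod m).real (bmzCorners E g) ≥ (m.prod m).real E ^ 4 - ε} ∧
            m.real {g : G |
              (m.prod m).real (bmzCorners E g) ≥ (m.prod m).real E ^ 4 - ε} ≥ 1 - ε := by
  refine ⟨20, by norm_num, fun ε hε hε2 => ⟨_, rfl, ?_⟩⟩
  intro G _ _ _ _ _ _ _ m _ _ hq E hE
  let _ := TopologicalSpace.metrizableSpaceMetric G
  have := isMulRightInvariant_of_compactSpace m
  have := isInvInvariant_of_compactSpace m
  rw [← BorelSpace.measurable_eq (α := G × G)] at hE
  have hκ := hq.isMixing m (Real.exp_pos _)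
  obtain ⟨k, hk, hk1, hk2⟩ := exists_parameters hε hε2
  let f : G × G → ℝ := E.indicator 1
  have hf : Measurable f := measurable_one.indicator hE
  have f0 : ∀ z, 0 ≤ f z := fun z => Set.indicator_nonneg (fun _ _ => zero_le_one) z
  have f1 : ∀ z, f z ≤ 1 := fun z => Set.indicator_le_self' (fun _ _ => zero_le_one) z
  have hmean := hκ.le_integral_cornerCount hf f0 f1 (by positivity : 0 < ε / 12) hk
  have hbad := hκ.measure_cornerCount_lt_le (c := (m.prod m).real E ^ 4) hε hk2 hf
    (fun z => abs_le.2 ⟨by linarith [f0 z], f1 z⟩) (by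
      rw [integral_indicator_one hE] at hmean
      linarith)
  have hcm := measurable_cornerCount (m := m) hf
  simp only [← cornerCount_indicator m hE, ge_iff_le]
  have hgood : MeasurableSet {g | (m.prod m).real E ^ 4 - ε ≤ cornerCount m (E.indicator 1) g} :=
    measurableSet_le measurable_const hcm
  refine ⟨hgood, ?_⟩
  have hcompl := probReal_compl_eq_one_sub (μ := m) hgood
  have heq : {g | (m.prod m).real E ^ 4 - ε ≤ cornerCount m (E.indicator 1) g}ᶜ
      = {g | cornerCount m f g < (m.prod m).real E ^ 4 - ε} := by
    ext g
    exact not_le (α := ℝ)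
  rw [heq] at hcompl
  linarith
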